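/- Let $d\ge 2$ and $0<a<b$. Let $(V(x))_{x\in\mathbb Z^d}$ be independent random variables with $\mathbb P\{V(x)=a\}=\mathbb P\{V(x)=b\}=1/2$ for every $x$. Let $H=-\frac1{2d}\Delta+V$ be the random Schrödinger operator on $\ell^2(\mathbb Z^d)$ given by \[ (H\psi)(x)=(1+V(x))\psi(x)-\frac1{2d}\sum_{y\sim x}\psi(y), \] where $y\sim x$ means that $y$ is one of the $2d$ nearest neighbours of $x$. Let $G=H^{-1}$, with matrix entries $G(x,y)$, and let \[ \rho(x,y)=\log\frac{\sqrt{G(x,x)\,G(y,y)}}{G(x,y)},\qquad \rho(x)=\rho(0,x). \] Then there is a constant $C=C_{a,b,d}>0$, depending only on $a$, $b$ and the dimension $d$, such that for every $x\in\mathbb Z^d$ the random variable $\rho(x)$ is square-integrable and \[ \mathrm{Var}\,\rho(x)\le C\,\frac{\|x\|}{\log(\|x\|+2)}, \] where $\|\cdot\|$ is the $\ell^1$ norm. -/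

import Mathlib

open MeasureTheory ProbabilityTheory
open scoped ENNReal lp

/-- The lattice `ℤ^d`. -/
abbrev Zd (d : ℕ) : Type := Fin d → ℤ

namespace Anderson

/-- The `ℓ¹` norm on `ℤ^d`. -/
def norm1 {d : ℕ} (x : Zd d) : ℝ := ∑ i, |(x i : ℝ)|

/-- The action of the Schrödinger operator `-(1/(2d)) Δ + V` on arbitrary real functions on `ℤ^d`:
`(H ψ)(x) = (1 + V(x)) ψ(x) - (1/(2d)) ∑_{y ∼ x} ψ(y)`.
The neighbours of `x` are the `2d` points `x ± e_i`. -/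
noncomputable def hamiltonian {d : ℕ} (V : Zd d → ℝ) (ψ : Zd d → ℝ) (x : Zd d) : ℝ :=
  (1 + V x) * ψ x
    - 1 / (2 * (d : ℝ)) * ∑ i : Fin d, (ψ (x + Pi.single i 1) + ψ (x - Pi.single i 1))

theorem hamiltonian_add {d : ℕ} (V ψ φ : Zd d → ℝ) :
    hamiltonian V (ψ + φ) = hamiltonian V ψ + hamiltonian V φ := by
  funext x
  simp only [hamiltonian, Pi.add_apply, Finset.sum_add_distrib]
  ring

theorem hamiltonian_smul {d : ℕ} (V : Zd d → ℝ) (c : ℝ) (ψ : Zd d → ℝ) :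
    hamiltonian V (c • ψ) = c • hamiltonian V ψ := by
  funext x
  simp only [hamiltonian, Pi.smul_apply, smul_eq_mul, ← mul_add, ← Finset.mul_sum]
  ring

/-- The Schrödinger operator `H` on `ℓ²(ℤ^d)`, on its maximal domain `{ψ ∈ ℓ² | H ψ ∈ ℓ²}`
(which is the whole space when `V` is bounded). -/
noncomputable def schrodingerOp {d : ℕ} (V : Zd d → ℝ) :
    ℓ²(Zd d, ℝ) →ₗ.[ℝ] ℓ²(Zd d, ℝ) where
  domain :=
    { carrier := {ψ | Memℓp (hamiltonian V ψ) 2}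
      zero_mem' := by
        have h : hamiltonian V ((0 : ℓ²(Zd d, ℝ)) : Zd d → ℝ) = 0 := by
          funext x
          simp [hamiltonian]
        simp only [Set.mem_ofPred_eq, h]
        exact zero_memℓp
      add_mem' := by
        intro ψ φ hψ hφ
        have h := Memℓp.add hψ hφ
        rw [← hamiltonian_add] at h
        exact h
      smul_mem' := by
        intro c ψ hψ
        have h := Memℓp.const_smul hψ c
        rw [← hamiltonian_smul] at h
        exact h }
  toFun :=
    { toFun := fun ψ => ⟨hamiltonian V ψ.1, ψ.2⟩
      map_add' := fun ψ φ => Subtype.ext (hamiltonian_add V ψ.1 φ.1)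
      map_smul' := fun c ψ => Subtype.ext (hamiltonian_smul V c ψ.1) }

open Classical in
/-- The Green function `G(x, y) = (H⁻¹ δ_y)(x)`, the matrix of the inverse operator `H⁻¹`.
(If `δ_y` is not in the range of `H` the value is `0`; this does not happen if `V ≥ a > 0`.) -/
noncomputable def green {d : ℕ} (V : Zd d → ℝ) (x y : Zd d) : ℝ :=
  if h : (lp.single 2 y (1 : ℝ) : ℓ²(Zd d, ℝ)) ∈ (schrodingerOp V).inverse.domain then
    ((schrodingerOp V).inverse ⟨_, h⟩ : Zd d → ℝ) x
  else 0

/-- The metric `ρ(x, y) = log (√(G(x, x) G(y, y)) / G(x, y))`. -/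
noncomputable def rho {d : ℕ} (V : Zd d → ℝ) (x y : Zd d) : ℝ :=
  Real.log (Real.sqrt (green V x x * green V y y) / green V x y)

end Anderson

/-! ### Fourier analysis on the discrete cube and the `L¹`-`L²` variance inequality. -/

namespace Cube

variable {ι : Type*}

/-! The argument follows the method of Benjamini, Kalai and Schramm for first passage percolation.
On the discrete cube, hypercontractivity (`Cube.avg_noise_pow_four_le`) implies that a function with
bounded increments, all of whose single-coordinate `L¹` influences are small, has variance smaller
by a logarithmic factor than its total influence (`Cube.variance_le`).

Changing the potential at `z` moves `log G(x, y)` by at most a constant times `G(x, z) G(z, y) /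
G(x, y)`, the mean time at `z` of the killed walk from `x` conditioned to end at `y`
(`exists_abs_log_green_sub_le`). The total time is linear in the distance (`exists_sum_tau_le`), and
the time in a set of diameter `D` with not too many points is `O(1 + D)`
(`exists_sum_tau_le_of_diam`). Both rest on `exp_sum_tau_mul_green_le`, which is Jensen's inequality
in the Feynman–Kac formula: lowering the potential by `s` on `B` multiplies `G(x, y)` by at least
`exp (s * time in B)`. The lowered Green function is bounded above trivially in the first case, and
by resolvent and Harnack estimates in the second.

The sites near `0` and `x` may have large influence, so `ρ(0, x)` is replaced by the average of
`ρ(w, x + w)` over `w` in a two-dimensional square of side `m`. A site then has influence `O(m) / m²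
= O(1 / m)`; this is where `d ≥ 2` enters. Since `ρ` is Lipschitz, the replacement costs `O(m)`.
With `N = ‖x‖`, taking `m ~ N ^ (1/4)` and `k ~ log N` makes both the variance of the average and
the squared error `O(N / log N)`. All of this is done for finitely many sites, and dominated
convergence gives the infinite lattice. -/

/-- The average of `f` over the subsets of `Λ`, that is, over the uniform measure on the cube
`{0, 1}^Λ`. -/
noncomputable def avg (Λ : Finset ι) (f : Finset ι → ℝ) : ℝ :=
  (∑ T ∈ Λ.powerset, f T) / 2 ^ Λ.card

/-- The Walsh function indexed by `S`. -/
def walsh [DecidableEq ι] (S T : Finset ι) : ℝ := ∏ i ∈ S, if i ∈ T then -1 else 1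

/-- The Walsh coefficient of `f` on the cube `{0, 1}^Λ`. -/
noncomputable def coeff [DecidableEq ι] (Λ : Finset ι) (f : Finset ι → ℝ) (S : Finset ι) : ℝ :=
  avg Λ fun T => f T * walsh S T

/-- Half of the increment of `f` when the coordinate `z` is flipped. -/
noncomputable def grad [DecidableEq ι] (z : ι) (f : Finset ι → ℝ) (T : Finset ι) : ℝ :=
  (f T - f (symmDiff T {z})) / 2

theorem avg_add (Λ : Finset ι) (f g : Finset ι → ℝ) :
    avg Λ (fun T => f T + g T) = avg Λ f + avg Λ g := by
  simp only [avg, Finset.sum_add_distrib, add_div]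

theorem avg_const_mul (Λ : Finset ι) (c : ℝ) (f : Finset ι → ℝ) :
    avg Λ (fun T => c * f T) = c * avg Λ f := by
  simp only [avg, ← Finset.mul_sum, mul_div_assoc]

theorem avg_sum {α : Type*} (Λ : Finset ι) (s : Finset α) (f : α → Finset ι → ℝ) :
    avg Λ (fun T => ∑ j ∈ s, f j T) = ∑ j ∈ s, avg Λ (f j) := by
  simp only [avg, Finset.sum_div]
  exact Finset.sum_comm

theorem avg_mono {Λ : Finset ι} {f g : Finset ι → ℝ} (h : ∀ T ⊆ Λ, f T ≤ g T) :
    avg Λ f ≤ avg Λ g := by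
  refine div_le_div_of_nonneg_right ?_ (by positivity)
  exact Finset.sum_le_sum fun T hT => h T (Finset.mem_powerset.1 hT)

theorem avg_congr {Λ : Finset ι} {f g : Finset ι → ℝ} (h : ∀ T ⊆ Λ, f T = g T) :
    avg Λ f = avg Λ g :=
  le_antisymm (avg_mono fun T hT => (h T hT).le) (avg_mono fun T hT => (h T hT).ge)

theorem avg_nonneg {Λ : Finset ι} {f : Finset ι → ℝ} (h : ∀ T ⊆ Λ, 0 ≤ f T) : 0 ≤ avg Λ f :=
  div_nonneg (Finset.sum_nonneg fun T hT => h T (Finset.mem_powerset.1 hT)) (by positivity)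

theorem avg_const (Λ : Finset ι) (c : ℝ) : avg Λ (fun _ => c) = c := by
  simp [avg, Finset.card_powerset]

theorem avg_mul_sq_le (Λ : Finset ι) (f g : Finset ι → ℝ) :
    avg Λ (fun T => f T * g T) ^ 2 ≤ avg Λ (fun T => f T ^ 2) * avg Λ (fun T => g T ^ 2) := by
  simp only [avg, div_pow, div_mul_div_comm]
  rw [← sq]
  exact div_le_div_of_nonneg_right (Finset.sum_mul_sq_le_sq_mul_sq _ _ _) (by positivity)

variable [DecidableEq ι]

theorem avg_insert {i : ι} {Λ : Finset ι} (hi : i ∉ Λ) (f : Finset ι → ℝ) :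
    avg (insert i Λ) f = avg Λ (fun T => (f T + f (insert i T)) / 2) := by
  simp only [avg, Finset.sum_powerset_insert hi, Finset.card_insert_of_notMem hi,
    ← Finset.sum_div, Finset.sum_add_distrib]
  rw [div_div, pow_succ']

theorem walsh_insert {i : ι} {S T : Finset ι} (hS : i ∉ S) (hT : i ∉ T) :
    walsh S (insert i T) = walsh S T ∧ walsh (insert i S) T = walsh S T ∧
      walsh (insert i S) (insert i T) = -walsh S T := by
  have h : walsh S (insert i T) = walsh S T := by
    refine Finset.prod_congr rfl fun j hj => ?_
    have : j ≠ i := fun e => hS (e ▸ hj)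
    simp [this]
  refine ⟨h, ?_, ?_⟩
  · simp [walsh, Finset.prod_insert hS, hT]
  · rw [← h]
    simp [walsh, Finset.prod_insert hS]

/-- Hypercontractivity of the noise operator with parameter `1 / 2`, from `L²` to `L⁴`. -/
theorem avg_noise_pow_four_le (Λ : Finset ι) (c : Finset ι → ℝ) :
    avg Λ (fun T => (∑ S ∈ Λ.powerset, (1 / 2) ^ S.card * c S * walsh S T) ^ 4)
      ≤ (∑ S ∈ Λ.powerset, c S ^ 2) ^ 2 := by
  induction Λ using Finset.induction_on generalizing c with
  | empty => simp [avg, walsh, ← pow_mul]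
  | insert i Λ hi ih =>
    set g : Finset ι → ℝ := fun T => ∑ S ∈ Λ.powerset, (1 / 2) ^ S.card * c S * walsh S T with hg
    set h : Finset ι → ℝ :=
      fun T => ∑ S ∈ Λ.powerset, (1 / 2) ^ S.card * c (insert i S) * walsh S T with hh
    have key : ∀ T ⊆ Λ,
        (∑ S ∈ (insert i Λ).powerset, (1 / 2) ^ S.card * c S * walsh S T = g T + h T / 2) ∧
        (∑ S ∈ (insert i Λ).powerset, (1 / 2) ^ S.card * c S * walsh S (insert i T)
          = g T - h T / 2) := by
      intro T hT
      have hiT : i ∉ T := fun e => hi (hT e)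
      have hiS : ∀ S ∈ Λ.powerset, i ∉ S := fun S hS e => hi (Finset.mem_powerset.1 hS e)
      rw [Finset.sum_powerset_insert hi, Finset.sum_powerset_insert hi, hg, hh, sub_eq_add_neg,
        Finset.sum_div, ← Finset.sum_neg_distrib]
      refine ⟨congrArg₂ _ rfl ?_, congrArg₂ _ ?_ ?_⟩
      · refine Finset.sum_congr rfl fun S hS => ?_
        rw [(walsh_insert (hiS S hS) hiT).2.1, Finset.card_insert_of_notMem (hiS S hS)]
        ring
      · refine Finset.sum_congr rfl fun S hS => ?_
        rw [(walsh_insert (hiS S hS) hiT).1]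
      · refine Finset.sum_congr rfl fun S hS => ?_
        rw [(walsh_insert (hiS S hS) hiT).2.2, Finset.card_insert_of_notMem (hiS S hS)]
        ring
    -- The odd powers of `h` cancel between the two values of coordinate `i`. The induction then
    -- closes because `A² + (3/2) A B + B² / 16 ≤ (A + B)²`, the mixed moment being controlled by
    -- Cauchy–Schwarz.
    have e1 : avg (insert i Λ)
        (fun T => (∑ S ∈ (insert i Λ).powerset, (1 / 2) ^ S.card * c S * walsh S T) ^ 4)
        = avg Λ (fun T => g T ^ 4) + 3 / 2 * avg Λ (fun T => g T ^ 2 * h T ^ 2)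
          + 1 / 16 * avg Λ (fun T => h T ^ 4) := by
      rw [avg_insert hi, ← avg_const_mul, ← avg_const_mul, ← avg_add, ← avg_add]
      refine avg_congr fun T hT => ?_
      rw [(key T hT).1, (key T hT).2]
      ring
    rw [e1, Finset.sum_powerset_insert hi]
    have hA := ih c
    have hB := ih fun S => c (insert i S)
    have hC := avg_mul_sq_le Λ (fun T => g T ^ 2) (fun T => h T ^ 2)
    simp only [← pow_mul] at hC
    norm_num at hC
    set A := ∑ S ∈ Λ.powerset, c S ^ 2
    set B := ∑ S ∈ Λ.powerset, c (insert i S) ^ 2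
    have hA0 : 0 ≤ A := Finset.sum_nonneg fun _ _ => sq_nonneg _
    have hB0 : 0 ≤ B := Finset.sum_nonneg fun _ _ => sq_nonneg _
    have hg0 : 0 ≤ avg Λ (fun T => g T ^ 4) := avg_nonneg fun T _ => by positivity
    have hh0 : 0 ≤ avg Λ (fun T => h T ^ 4) := avg_nonneg fun T _ => by positivity
    have hD : avg Λ (fun T => g T ^ 2 * h T ^ 2) ≤ A * B := by
      refine (sq_le_sq₀ (avg_nonneg fun T _ => by positivity) (by positivity)).1 ?_
      calc _ ≤ _ := hC
        _ ≤ A ^ 2 * B ^ 2 := mul_le_mul hA hB hh0 (by positivity)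
        _ = _ := by ring
    nlinarith [mul_nonneg hA0 hB0, sq_nonneg B]

/-- The sum factors as a product over `Λ` of `1 ± 1`, and a point that separates `T` from `T'`
contributes a zero factor. -/
theorem sum_walsh_mul_walsh {Λ T T' : Finset ι} (hT : T ⊆ Λ) (hT' : T' ⊆ Λ) :
    ∑ S ∈ Λ.powerset, walsh S T * walsh S T' = if T = T' then 2 ^ Λ.card else 0 := by
  simp only [walsh, ← Finset.prod_mul_distrib]
  rw [← Finset.prod_one_add]
  split_ifs with h
  · subst h
    rw [← Finset.prod_const]
    refine Finset.prod_congr rfl fun i _ => ?_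
    split_ifs <;> norm_num
  · obtain ⟨i, hi⟩ : ∃ i, ¬(i ∈ T ↔ i ∈ T') := by
      by_contra hc
      push Not at hc
      exact h (Finset.ext hc)
    have hiΛ : i ∈ Λ := by
      by_contra hc
      exact hi ⟨fun e => absurd (hT e) hc, fun e => absurd (hT' e) hc⟩
    refine Finset.prod_eq_zero hiΛ ?_
    by_cases h1 : i ∈ T <;> by_cases h2 : i ∈ T' <;> simp_all

theorem sum_coeff_mul_walsh {Λ T : Finset ι} (hT : T ⊆ Λ) (f : Finset ι → ℝ) :
    ∑ S ∈ Λ.powerset, coeff Λ f S * walsh S T = f T := by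
  simp only [coeff, avg, div_mul_eq_mul_div, ← Finset.sum_div, Finset.sum_mul]
  rw [Finset.sum_comm, div_eq_iff (by positivity)]
  simp only [mul_assoc, ← Finset.mul_sum]
  rw [Finset.sum_eq_single_of_mem T (Finset.mem_powerset.2 hT)]
  · rw [sum_walsh_mul_walsh hT hT, if_pos rfl]
  · intro T' hT' hne
    rw [sum_walsh_mul_walsh (Finset.mem_powerset.1 hT') hT, if_neg hne, mul_zero]

theorem avg_mul_sum_walsh (Λ : Finset ι) (f : Finset ι → ℝ) (c : Finset ι → ℝ)
    (s : Finset (Finset ι)) :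
    avg Λ (fun T => f T * ∑ S ∈ s, c S * walsh S T) = ∑ S ∈ s, c S * coeff Λ f S := by
  simp only [coeff, ← avg_const_mul, ← avg_sum, Finset.mul_sum]
  refine avg_congr fun T _ => Finset.sum_congr rfl fun S _ => by ring

theorem avg_sq (Λ : Finset ι) (f : Finset ι → ℝ) :
    avg Λ (fun T => f T ^ 2) = ∑ S ∈ Λ.powerset, coeff Λ f S ^ 2 := by
  simp only [sq]
  rw [← avg_mul_sum_walsh]
  exact avg_congr fun T hT => by rw [sum_coeff_mul_walsh hT]

theorem coeff_empty (Λ : Finset ι) (f : Finset ι → ℝ) : coeff Λ f ∅ = avg Λ f := by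
  simp [coeff, walsh]

theorem walsh_symmDiff (S T : Finset ι) (z : ι) :
    walsh S (symmDiff T {z}) = if z ∈ S then -walsh S T else walsh S T := by
  have hne : ∀ j, j ≠ z → ((j ∈ symmDiff T {z}) ↔ j ∈ T) := fun j hj => by
    simp [Finset.mem_symmDiff, hj]
  split_ifs with h
  · rw [walsh, walsh, ← Finset.mul_prod_erase _ _ h, ← Finset.mul_prod_erase _ _ h, ← neg_mul]
    congr 1
    · by_cases hz : z ∈ T <;> simp [Finset.mem_symmDiff, hz]
    · exact Finset.prod_congr rfl fun j hj => by rw [if_congr (hne j (Finset.ne_of_mem_erase hj)) rfl rfl]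
  · refine Finset.prod_congr rfl fun j hj => ?_
    rw [if_congr (hne j fun e => h (e ▸ hj)) rfl rfl]

theorem symmDiff_singleton_subset {Λ T : Finset ι} {z : ι} (hz : z ∈ Λ) (hT : T ⊆ Λ) :
    symmDiff T {z} ⊆ Λ := by
  intro j hj
  rcases Finset.mem_symmDiff.1 hj with h | h
  · exact hT h.1
  · exact Finset.mem_singleton.1 h.1 ▸ hz

theorem avg_symmDiff {Λ : Finset ι} {z : ι} (hz : z ∈ Λ) (f : Finset ι → ℝ) :
    avg Λ (fun T => f (symmDiff T {z})) = avg Λ f := by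
  unfold avg
  congr 1
  refine Finset.sum_nbij' (fun T => symmDiff T {z}) (fun T => symmDiff T {z}) ?_ ?_ ?_ ?_ ?_
  · exact fun T hT => Finset.mem_powerset.2 (symmDiff_singleton_subset hz (Finset.mem_powerset.1 hT))
  · exact fun T hT => Finset.mem_powerset.2 (symmDiff_singleton_subset hz (Finset.mem_powerset.1 hT))
  · exact fun T _ => symmDiff_symmDiff_cancel_right _ _
  · exact fun T _ => symmDiff_symmDiff_cancel_right _ _
  · exact fun T _ => rfl

/-- Flipping `z` changes the sign of exactly the Walsh functions with `z ∈ S`, so the half-increment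
is the projection onto their span. Summing over `z` therefore counts each coefficient `S.card`
times. -/
theorem coeff_grad {Λ : Finset ι} {z : ι} (hz : z ∈ Λ) (f : Finset ι → ℝ) (S : Finset ι) :
    coeff Λ (grad z f) S = if z ∈ S then coeff Λ f S else 0 := by
  have h1 : avg Λ (fun T => f (symmDiff T {z}) * walsh S T)
      = avg Λ (fun T => f T * walsh S (symmDiff T {z})) := by
    rw [← avg_symmDiff hz fun T => f T * walsh S (symmDiff T {z})]
    simp only [symmDiff_symmDiff_cancel_right]
  have h2 : coeff Λ (grad z f) S
      = 1 / 2 * coeff Λ f S + -(1 / 2) * avg Λ (fun T => f (symmDiff T {z}) * walsh S T) := by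
    rw [coeff, coeff, ← avg_const_mul, ← avg_const_mul, ← avg_add]
    exact avg_congr fun T _ => by rw [grad]; ring
  rw [h2, h1]
  simp only [walsh_symmDiff]
  split_ifs
  · have : avg Λ (fun T => f T * -walsh S T) = -1 * coeff Λ f S := by
      rw [coeff, ← avg_const_mul]
      exact avg_congr fun T _ => by ring
    rw [this]; ring
  · rw [coeff]; ring

/-- The low-degree part of a bounded function with small `L¹` norm has small `L²` norm. -/
theorem sum_coeff_sq_le (Λ : Finset ι) (g : Finset ι → ℝ) {M ε : ℝ} (k : ℕ) (hM0 : 0 ≤ M)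
    (hM : ∀ T ⊆ Λ, |g T| ≤ M) (hε : avg Λ (fun T => |g T|) ≤ ε) :
    ∑ S ∈ Λ.powerset with S.card ≤ k, coeff Λ g S ^ 2
      ≤ 4 ^ k * √(M * ε) * avg Λ (fun T => |g T|) := by
  set Q := ∑ S ∈ Λ.powerset with S.card ≤ k, coeff Λ g S ^ 2 with hQ
  set A := avg Λ (fun T => |g T|) with hA
  have hQ0 : 0 ≤ Q := Finset.sum_nonneg fun _ _ => sq_nonneg _
  have hA0 : 0 ≤ A := avg_nonneg fun _ _ => abs_nonneg _
  set c : Finset ι → ℝ := fun S => if S.card ≤ k then coeff Λ g S else 0 with hc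
  set P : Finset ι → ℝ := fun T => ∑ S ∈ Λ.powerset, c S * walsh S T with hP
  have h1 : avg Λ (fun T => g T * P T) = Q := by
    rw [avg_mul_sum_walsh, hQ, Finset.sum_filter]
    refine Finset.sum_congr rfl fun S _ => ?_
    simp only [hc]
    split_ifs <;> ring
  have h2 : avg Λ (fun T => P T ^ 4) ≤ (4 ^ k * Q) ^ 2 := by
    -- The weights `2 ^ S.card` undo the noise; on degrees at most `k` they cost a factor `4 ^ k` in
    -- the squared `L²` norm.
    have := avg_noise_pow_four_le Λ fun S => 2 ^ S.card * c S
    have e : ∀ T, ∑ S ∈ Λ.powerset, (1 / 2) ^ S.card * (2 ^ S.card * c S) * walsh S T = P T := by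
      intro T
      refine Finset.sum_congr rfl fun S _ => ?_
      rw [← mul_assoc ((1 / 2 : ℝ) ^ S.card), ← mul_pow]
      norm_num
    simp only [e] at this
    refine this.trans (pow_le_pow_left₀ (Finset.sum_nonneg fun _ _ => sq_nonneg _) ?_ 2)
    rw [hQ, Finset.sum_filter, Finset.mul_sum]
    refine Finset.sum_le_sum fun S _ => ?_
    simp only [hc]
    split_ifs with h
    · rw [mul_pow, ← pow_mul, mul_comm S.card, pow_mul]
      norm_num
      exact mul_le_mul_of_nonneg_right (pow_le_pow_right₀ (by norm_num) h) (sq_nonneg _)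
    · simp
  have h3 : avg Λ (fun T => g T ^ 2) ≤ M * A := by
    rw [hA, ← avg_const_mul]
    refine avg_mono fun T hT => ?_
    rw [← sq_abs, sq]
    exact mul_le_mul_of_nonneg_right (hM T hT) (abs_nonneg _)
  -- Two applications of Cauchy–Schwarz, splitting `|g|` into square roots first, play the role of
  -- Hölder's inequality with exponents `4/3` and `4`.
  have h4 : Q ^ 2 ≤ A * avg Λ (fun T => |g T| * P T ^ 2) := by
    have := avg_mul_sq_le Λ (fun T => √|g T|) (fun T => √|g T| * |P T|)
    simp only [mul_pow, Real.sq_sqrt (abs_nonneg _), sq_abs] at this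
    refine le_trans (pow_le_pow_left₀ hQ0 ?_ 2) this
    rw [← h1]
    refine avg_mono fun T _ => ?_
    rw [← mul_assoc, Real.mul_self_sqrt (abs_nonneg _), ← abs_mul]
    exact le_abs_self _
  have h5 : avg Λ (fun T => |g T| * P T ^ 2) ^ 2 ≤ (M * A) * (4 ^ k * Q) ^ 2 := by
    have := avg_mul_sq_le Λ (fun T => |g T|) (fun T => P T ^ 2)
    simp only [sq_abs, ← pow_mul] at this
    refine this.trans (mul_le_mul h3 h2 (avg_nonneg fun _ _ => by rw [pow_mul]; positivity) (mul_nonneg hM0 hA0))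
  rcases hQ0.eq_or_lt with h0 | hpos
  · rw [← h0]; positivity
  have h6 : Q ^ 4 ≤ A ^ 2 * ((M * A) * (4 ^ k * Q) ^ 2) := by
    calc Q ^ 4 = (Q ^ 2) ^ 2 := by ring
      _ ≤ (A * avg Λ (fun T => |g T| * P T ^ 2)) ^ 2 := pow_le_pow_left₀ (by positivity) h4 2
      _ ≤ _ := by rw [mul_pow]; exact mul_le_mul_of_nonneg_left h5 (by positivity)
  have h7 : Q ^ 2 ≤ (4 ^ k) ^ 2 * (M * A) * A ^ 2 := by
    refine le_of_mul_le_mul_right ?_ (pow_pos hpos 2)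
    calc Q ^ 2 * Q ^ 2 = Q ^ 4 := by ring
      _ ≤ _ := h6
      _ = _ := by ring
  refine (sq_le_sq₀ hQ0 (by positivity)).1 ?_
  rw [mul_pow, mul_pow, Real.sq_sqrt (mul_nonneg hM0 (hA0.trans hε))]
  refine h7.trans ?_
  gcongr

/-- An `L¹`-`L²` bound on the variance of functions with bounded increments on the cube. -/
theorem variance_le (Λ : Finset ι) (f : Finset ι → ℝ) {M ε : ℝ} (k : ℕ) (hM0 : 0 ≤ M)
    (hM : ∀ z ∈ Λ, ∀ T ⊆ Λ, |grad z f T| ≤ M)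
    (hε : ∀ z ∈ Λ, avg Λ (fun T => |grad z f T|) ≤ ε) :
    avg Λ (fun T => f T ^ 2) - avg Λ f ^ 2
      ≤ (M / (k + 1) + 4 ^ k * √(M * ε)) * ∑ z ∈ Λ, avg Λ (fun T => |grad z f T|) := by
  have e1 : avg Λ (fun T => f T ^ 2) - avg Λ f ^ 2
      = ∑ S ∈ Λ.powerset.erase ∅, coeff Λ f S ^ 2 := by
    rw [avg_sq, ← coeff_empty, ← Finset.add_sum_erase _ _ (Finset.empty_mem_powerset Λ)]
    ring
  -- Degrees above `k` gain the factor `1 / (k + 1)` because each is counted at least `k + 1` times;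
  -- the low degrees are left to `sum_coeff_sq_le`.
  have e2 : ∀ S ∈ Λ.powerset.erase ∅, coeff Λ f S ^ 2 ≤
      (∑ z ∈ Λ, coeff Λ (grad z f) S ^ 2) / (k + 1)
        + ∑ z ∈ Λ, if S.card ≤ k then coeff Λ (grad z f) S ^ 2 else 0 := by
    intro S hS
    obtain ⟨hne, hS⟩ := Finset.mem_erase.1 hS
    have h1 : ∑ z ∈ Λ, coeff Λ (grad z f) S ^ 2 = S.card * coeff Λ f S ^ 2 := by
      rw [← nsmul_eq_mul, ← Finset.sum_const,
        ← Finset.sum_subset (Finset.mem_powerset.1 hS)]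
      · exact Finset.sum_congr rfl fun z hz => by
          rw [coeff_grad (Finset.mem_powerset.1 hS hz), if_pos hz]
      · exact fun z hz hzS => by rw [coeff_grad hz, if_neg hzS]; simp
    have hc : 1 ≤ S.card := Finset.card_pos.2 (Finset.nonempty_iff_ne_empty.2 hne)
    split_ifs with h
    · rw [h1]
      have : (1 : ℝ) ≤ S.card := by exact_mod_cast hc
      have h2 := mul_le_mul_of_nonneg_right this (sq_nonneg (coeff Λ f S))
      have : 0 ≤ S.card * coeff Λ f S ^ 2 / ((k : ℝ) + 1) := by positivity
      linarith
    · rw [h1, Finset.sum_const_zero, add_zero, le_div_iff₀ (by positivity), mul_comm]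
      have : (k : ℝ) + 1 ≤ S.card := by exact_mod_cast (not_le.1 h)
      exact mul_le_mul_of_nonneg_right this (sq_nonneg _)
  have e3 : ∀ z ∈ Λ, ∑ S ∈ Λ.powerset, coeff Λ (grad z f) S ^ 2
      ≤ M * avg Λ (fun T => |grad z f T|) := by
    intro z hz
    rw [← avg_sq, ← avg_const_mul]
    refine avg_mono fun T hT => ?_
    rw [← sq_abs, sq]
    exact mul_le_mul_of_nonneg_right (hM z hz T hT) (abs_nonneg _)
  rw [e1]
  calc _ ≤ ∑ S ∈ Λ.powerset, ((∑ z ∈ Λ, coeff Λ (grad z f) S ^ 2) / (k + 1)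
        + ∑ z ∈ Λ, if S.card ≤ k then coeff Λ (grad z f) S ^ 2 else 0) := by
        refine (Finset.sum_le_sum e2).trans ?_
        refine Finset.sum_le_sum_of_subset_of_nonneg (Finset.erase_subset _ _) fun S _ _ => ?_
        refine add_nonneg (div_nonneg (Finset.sum_nonneg fun _ _ => sq_nonneg _) (by positivity))
          (Finset.sum_nonneg fun _ _ => ?_)
        split_ifs <;> positivity
    _ = (∑ z ∈ Λ, ∑ S ∈ Λ.powerset, coeff Λ (grad z f) S ^ 2) / (k + 1)
        + ∑ z ∈ Λ, ∑ S ∈ Λ.powerset with S.card ≤ k, coeff Λ (grad z f) S ^ 2 := by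
        rw [Finset.sum_add_distrib, ← Finset.sum_div, Finset.sum_comm]
        congr 1
        rw [Finset.sum_comm]
        simp only [Finset.sum_filter]
    _ ≤ (∑ z ∈ Λ, M * avg Λ (fun T => |grad z f T|)) / (k + 1)
        + ∑ z ∈ Λ, 4 ^ k * √(M * ε) * avg Λ (fun T => |grad z f T|) := by
        refine add_le_add (div_le_div_of_nonneg_right (Finset.sum_le_sum e3) (by positivity))
          (Finset.sum_le_sum fun z hz => ?_)
        exact sum_coeff_sq_le Λ _ k hM0 (hM z hz) (hε z hz)
    _ = _ := by
        rw [← Finset.mul_sum, ← Finset.mul_sum]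
        ring

end Cube

/-! ### The Hamiltonian acting on functions on the lattice. -/

namespace Anderson

variable {d : ℕ}

/-- The average of `ψ` over the nearest neighbours of `x`. -/
noncomputable def nbrAvg (ψ : Zd d → ℝ) (x : Zd d) : ℝ :=
  1 / (2 * (d : ℝ)) * ∑ i : Fin d, (ψ (x + Pi.single i 1) + ψ (x - Pi.single i 1))

theorem hamiltonian_eq (V ψ : Zd d → ℝ) (x : Zd d) :
    hamiltonian V ψ x = (1 + V x) * ψ x - nbrAvg ψ x := rfl

theorem hamiltonian_sub (V ψ φ : Zd d → ℝ) (x : Zd d) :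
    hamiltonian V (fun z => ψ z - φ z) x = hamiltonian V ψ x - hamiltonian V φ x := by
  have : (fun z => ψ z - φ z) = ψ + (-1 : ℝ) • φ := by
    funext z
    simp [sub_eq_add_neg]
  rw [this, hamiltonian_add, hamiltonian_smul]
  simp [sub_eq_add_neg]

theorem hamiltonian_const_mul (V : Zd d → ℝ) (c : ℝ) (ψ : Zd d → ℝ) (x : Zd d) :
    hamiltonian V (fun z => c * ψ z) x = c * hamiltonian V ψ x :=
  congrFun (hamiltonian_smul V c ψ) x

theorem hamiltonian_finset_sum {α : Type*} (V : Zd d → ℝ) (s : Finset α) (ψ : α → Zd d → ℝ)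
    (x : Zd d) :
    hamiltonian V (fun z => ∑ j ∈ s, ψ j z) x = ∑ j ∈ s, hamiltonian V (ψ j) x := by
  classical
  induction s using Finset.induction_on with
  | empty => simp [hamiltonian]
  | insert j s hj ih =>
    simp only [Finset.sum_insert hj]
    rw [← ih]
    exact congrFun (hamiltonian_add V (ψ j) fun z => ∑ j ∈ s, ψ j z) x

theorem nbrAvg_mono {ψ φ : Zd d → ℝ} (h : ∀ y, ψ y ≤ φ y) (x : Zd d) :
    nbrAvg ψ x ≤ nbrAvg φ x :=
  mul_le_mul_of_nonneg_left (Finset.sum_le_sum fun _ _ => add_le_add (h _) (h _)) (by positivity)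

theorem nbrAvg_nonneg {ψ : Zd d → ℝ} (h : ∀ y, 0 ≤ ψ y) (x : Zd d) : 0 ≤ nbrAvg ψ x :=
  mul_nonneg (by positivity) (Finset.sum_nonneg fun _ _ => add_nonneg (h _) (h _))

/-- The `ℓ¹` norm on `ℤ^d`, as a natural number. -/
def natNorm (x : Zd d) : ℕ := ∑ i, (x i).natAbs

theorem natNorm_cast (x : Zd d) : (natNorm x : ℝ) = norm1 x := by
  simp [natNorm, norm1, Nat.cast_natAbs]

/-- The constant in the Harnack inequality for neighbouring sites. -/
noncomputable def harnackConst (d : ℕ) (b : ℝ) : ℝ := 2 * d * (1 + b)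

/-- Needed so that the cardinality of a square is absorbed by a power of the Harnack constant. -/
theorem four_le_harnackConst (hd : 2 ≤ d) {b : ℝ} (hb : 0 < b) : 4 ≤ harnackConst d b := by
  have : (2 : ℝ) ≤ d := by exact_mod_cast hd
  unfold harnackConst
  nlinarith

theorem hasSum_comp_add {ψ : Zd d → ℝ} {s : ℝ} (h : HasSum ψ s) (e : Zd d) :
    HasSum (fun x => ψ (x + e)) s := by
  simpa only [Function.comp_def, Equiv.coe_addRight] using (Equiv.addRight e).hasSum_iff.2 h

/-- The Hamiltonian is symmetric, for the pairing of summable and bounded functions. -/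
theorem hasSum_mul_hamiltonian_sub {f g : Zd d → ℝ} {K : ℝ} (hf : Summable f)
    (hg : ∀ x, |g x| ≤ K) (V : Zd d → ℝ) :
    HasSum (fun x => f x * hamiltonian V g x - hamiltonian V f x * g x) 0 := by
  have hs : ∀ e : Zd d, Summable fun x => f x * g (x + e) := fun e =>
    Summable.of_norm_bounded (hf.abs.mul_right K) fun x => by
      rw [Real.norm_eq_abs, abs_mul]
      exact mul_le_mul_of_nonneg_left (hg _) (abs_nonneg _)
  -- The potential terms cancel pointwise. Only the hopping terms remain, and they cancel after a
  -- translation, with `e` and `-e` taken together.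
  have h1 : ∀ e : Zd d, HasSum (fun x => f x * g (x + e) - f (x - e) * g x) 0 := by
    intro e
    have h3 := (hs e).hasSum.sub (hasSum_comp_add (hs e).hasSum (-e))
    simpa [← sub_eq_add_neg] using h3
  have h4 := (hasSum_sum fun i (_ : i ∈ (Finset.univ : Finset (Fin d))) =>
    (h1 (Pi.single i 1)).add (h1 (-Pi.single i 1))).mul_left (-(1 / (2 * (d : ℝ))))
  simp only [add_zero, Finset.sum_const_zero, mul_zero] at h4
  refine (congrArg (fun F => HasSum F 0) (funext fun x => ?_)).mpr h4
  simp only [hamiltonian, Finset.sum_add_distrib, Finset.sum_sub_distrib, ← sub_eq_add_neg,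
    sub_neg_eq_add, ← Finset.mul_sum, ← Finset.sum_mul]
  ring

variable [NeZero d]

theorem nbrAvg_const (c : ℝ) (x : Zd d) : nbrAvg (fun _ => c) x = c := by
  have : (d : ℝ) ≠ 0 := Nat.cast_ne_zero.2 (NeZero.ne d)
  simp only [nbrAvg, Finset.sum_const, Finset.card_univ, Fintype.card_fin, nsmul_eq_mul]
  field_simp
  ring

theorem hasSum_nbrAvg {ψ : Zd d → ℝ} {s : ℝ} (h : HasSum ψ s) : HasSum (nbrAvg ψ) s := by
  have h1 : ∀ i : Fin d, HasSum (fun x => ψ (x + Pi.single i 1) + ψ (x - Pi.single i 1)) (s + s) :=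
    fun i => by
      have h1 := hasSum_comp_add h (Pi.single i 1)
      have h2 := hasSum_comp_add h (-Pi.single i 1)
      simp only [← sub_eq_add_neg] at h2
      exact h1.add h2
  have h2 := (hasSum_sum fun i (_ : i ∈ Finset.univ) => h1 i).mul_left (1 / (2 * (d : ℝ)))
  have e : 1 / (2 * (d : ℝ)) * ∑ _i : Fin d, (s + s) = s := by
    have : (d : ℝ) ≠ 0 := Nat.cast_ne_zero.2 (NeZero.ne d)
    simp only [Finset.sum_const, Finset.card_univ, Fintype.card_fin, nsmul_eq_mul]
    field_simp
    ring
  rw [e] at h2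
  exact h2

/-! ### Maximum principle, Green function, resolvent identity and Harnack inequality. -/

variable {V : Zd d → ℝ} {a b : ℝ}

/-- The maximum principle. -/
theorem nonpos_of_hamiltonian_nonpos (ha : 0 < a) (hV : ∀ z, a ≤ V z) {u : Zd d → ℝ} {K : ℝ}
    (hK : ∀ x, u x ≤ K) (hu : ∀ x, 0 < u x → hamiltonian V u x ≤ 0) (x : Zd d) : u x ≤ 0 := by
  by_contra! hx
  have hb : BddAbove (Set.range u) := ⟨K, by rintro _ ⟨y, rfl⟩; exact hK y⟩
  have hM : 0 < ⨆ y, u y := hx.trans_le (le_ciSup hb x)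
  set M := ⨆ y, u y
  -- The supremum need not be attained, so each value is compared with it: where `u > 0`, `(1 + a) u
  -- ≤ nbrAvg u ≤ M`.
  have h : M ≤ M / (1 + a) := by
    refine ciSup_le fun y => ?_
    rw [le_div_iff₀ (by positivity)]
    rcases le_or_gt (u y) 0 with h0 | h0
    · nlinarith
    · have h1 := hu y h0
      rw [hamiltonian_eq] at h1
      have h2 : nbrAvg u y ≤ M := by
        rw [← nbrAvg_const M y]
        exact nbrAvg_mono (fun z => le_ciSup hb z) y
      nlinarith [hV y]
  rw [le_div_iff₀ (by positivity)] at h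
  nlinarith

theorem le_of_hamiltonian_le (ha : 0 < a) (hV : ∀ z, a ≤ V z) {u v : Zd d → ℝ} {K : ℝ}
    (hK : ∀ x, u x - v x ≤ K) (h : ∀ x, hamiltonian V u x ≤ hamiltonian V v x) (x : Zd d) :
    u x ≤ v x := by
  have := nonpos_of_hamiltonian_nonpos ha hV hK
    (fun y _ => by rw [hamiltonian_sub]; exact sub_nonpos.2 (h y)) x
  linarith

/-- The solution is the increasing limit of the Neumann (Jacobi) iteration started at `0`. One step
sends a mass bound `s` to `(1 + s) / (1 + a)`, whose fixed point is `1 / a`; this gives summability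
uniformly in the step. -/
theorem exists_summable_hamiltonian_eq (ha : 0 < a) (hV : ∀ z, a ≤ V z) (y : Zd d) :
    ∃ g : Zd d → ℝ, (∀ x, 0 ≤ g x) ∧ Summable g ∧ ∑' x, g x ≤ 1 / a ∧
      ∀ x, hamiltonian V g x = if x = y then 1 else 0 := by
  have hV0 : ∀ z, 0 < 1 + V z := fun z => by linarith [hV z]
  let F : (Zd d → ℝ) → Zd d → ℝ := fun u x => ((if x = y then 1 else 0) + nbrAvg u x) / (1 + V x)
  have hFmono : ∀ {u v : Zd d → ℝ}, (∀ x, u x ≤ v x) → ∀ x, F u x ≤ F v x := fun h x =>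
    div_le_div_of_nonneg_right (add_le_add le_rfl (nbrAvg_mono h x)) (hV0 x).le
  let u : ℕ → Zd d → ℝ := fun n => F^[n] 0
  have hsucc : ∀ n, u (n + 1) = F (u n) := fun n => Function.iterate_succ_apply' F n 0
  have hnn : ∀ n x, 0 ≤ u n x := by
    intro n
    induction n with
    | zero => exact fun x => le_rfl
    | succ n ih =>
      intro x
      rw [hsucc]
      refine div_nonneg (add_nonneg ?_ (nbrAvg_nonneg ih x)) (hV0 x).le
      split_ifs <;> norm_num
  have hmono : ∀ n x, u n x ≤ u (n + 1) x := by
    intro n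
    induction n with
    | zero => exact fun x => hnn 1 x
    | succ n ih =>
      intro x
      rw [hsucc n, hsucc (n + 1)]
      exact hFmono ih x
  have hsum : ∀ n, ∃ s ≤ 1 / a, HasSum (u n) s := by
    intro n
    induction n with
    | zero => exact ⟨0, by positivity, hasSum_zero⟩
    | succ n ih =>
      obtain ⟨s, hs, h⟩ := ih
      have h1 : HasSum (fun x => ((if x = y then 1 else 0) + nbrAvg (u n) x) / (1 + a))
          ((1 + s) / (1 + a)) := ((hasSum_ite_eq y 1).add (hasSum_nbrAvg h)).div_const _
      have hle : ∀ x, u (n + 1) x ≤ ((if x = y then 1 else 0) + nbrAvg (u n) x) / (1 + a) := by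
        intro x
        rw [hsucc]
        refine div_le_div_of_nonneg_left (add_nonneg ?_ (nbrAvg_nonneg (hnn n) x)) (by positivity)
          (by linarith [hV x])
        split_ifs <;> norm_num
      have h2 : Summable (u (n + 1)) := Summable.of_nonneg_of_le (hnn _) hle h1.summable
      refine ⟨_, (hasSum_le hle h2.hasSum h1).trans ?_, h2.hasSum⟩
      rw [div_le_div_iff₀ (by positivity) ha]
      rw [le_div_iff₀ ha] at hs
      linarith
  have hfin : ∀ n (S : Finset (Zd d)), ∑ x ∈ S, u n x ≤ 1 / a := by
    intro n S
    obtain ⟨s, hs, h⟩ := hsum n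
    exact (sum_le_hasSum S (fun x _ => hnn n x) h).trans hs
  have hbdd : ∀ x, BddAbove (Set.range fun n => u n x) := by
    refine fun x => ⟨1 / a, ?_⟩
    rintro _ ⟨n, rfl⟩
    simpa using hfin n {x}
  let g : Zd d → ℝ := fun x => ⨆ n, u n x
  have hlim : ∀ x, Filter.Tendsto (fun n => u n x) Filter.atTop (nhds (g x)) := fun x =>
    tendsto_atTop_ciSup (monotone_nat_of_le_succ fun n => hmono n x) (hbdd x)
  have hg0 : ∀ x, 0 ≤ g x := fun x => ge_of_tendsto' (hlim x) fun n => hnn n x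
  have hgfin : ∀ S : Finset (Zd d), ∑ x ∈ S, g x ≤ 1 / a := fun S =>
    le_of_tendsto' (tendsto_finsetSum S fun x _ => hlim x) fun n => hfin n S
  have hgs : Summable g := summable_of_sum_le hg0 hgfin
  refine ⟨g, hg0, hgs, hgs.tsum_le_of_sum_le hgfin, fun x => ?_⟩
  have h1 : Filter.Tendsto (fun n => hamiltonian V (u n) x) Filter.atTop
      (nhds (hamiltonian V g x)) :=
    ((hlim x).const_mul _).sub ((tendsto_finsetSum _ fun i _ => (hlim _).add (hlim _)).const_mul _)
  have h2 : Filter.Tendsto (fun n => (1 + V x) * u (n + 1) x - nbrAvg (u n) x) Filter.atTop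
      (nhds (hamiltonian V g x)) :=
    (((hlim x).comp (Filter.tendsto_add_atTop_nat 1)).const_mul _).sub
      ((tendsto_finsetSum _ fun i _ => (hlim _).add (hlim _)).const_mul _)
  refine tendsto_nhds_unique h2 ?_
  have : ∀ n, (1 + V x) * u (n + 1) x - nbrAvg (u n) x = if x = y then 1 else 0 := by
    intro n
    rw [hsucc]
    simp only [F]
    rw [mul_div_cancel₀ _ (hV0 x).ne']
    ring
  simp only [this]
  exact tendsto_const_nhds

/-- The link with the operator-theoretic definition: a summable function lies in `ℓ²`, and the
maximum principle applied to `ψ` and `-ψ` makes the operator injective there. -/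
theorem green_eq_of_hamiltonian_eq (ha : 0 < a) (hV : ∀ z, a ≤ V z) {y : Zd d} {g : Zd d → ℝ}
    (hg : Summable g) (h : ∀ x, hamiltonian V g x = if x = y then 1 else 0) (x : Zd d) :
    green V x y = g x := by
  have hker : LinearMap.ker (schrodingerOp V).toFun = ⊥ := by
    refine LinearMap.ker_eq_bot'.2 fun ψ hψ => ?_
    have h0 : ∀ x, hamiltonian V (ψ.1 : Zd d → ℝ) x = 0 := fun x =>
      congrFun (congrArg (fun φ : ℓ²(Zd d, ℝ) => (φ : Zd d → ℝ)) hψ) x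
    have hb : ∀ x, |(ψ.1 : Zd d → ℝ) x| ≤ ‖ψ.1‖ := fun x =>
      lp.norm_apply_le_norm (by norm_num) ψ.1 x
    have hle : ∀ x, (ψ.1 : Zd d → ℝ) x ≤ 0 :=
      nonpos_of_hamiltonian_nonpos ha hV (fun x => (abs_le.1 (hb x)).2) fun x _ => (h0 x).le
    have hge : ∀ x, -1 * (ψ.1 : Zd d → ℝ) x ≤ 0 :=
      nonpos_of_hamiltonian_nonpos ha hV (K := ‖ψ.1‖)
        (fun x => by linarith [(abs_le.1 (hb x)).1])
        fun x _ => by rw [hamiltonian_const_mul, h0, mul_zero]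
    refine Subtype.ext (lp.ext (funext fun x => ?_))
    refine le_antisymm (hle x) ?_
    have := hge x
    rw [neg_one_mul] at this
    exact neg_nonpos.1 this
  have hmem : Memℓp g 2 := by
    have : Memℓp g 1 := memℓp_gen (by simpa using hg.abs)
    exact this.of_exponent_ge (by norm_num)
  let G : ℓ²(Zd d, ℝ) := ⟨g, hmem⟩
  have hfun : hamiltonian V (G : Zd d → ℝ) = ((lp.single 2 y (1 : ℝ) : ℓ²(Zd d, ℝ)) : Zd d → ℝ) := by
    funext z
    rw [show hamiltonian V (G : Zd d → ℝ) z = _ from h z, lp.coeFn_single, Pi.single_apply]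
  have hdom : G ∈ (schrodingerOp V).domain := by
    change Memℓp (hamiltonian V (G : Zd d → ℝ)) 2
    rw [hfun]
    exact lp.memℓp _
  have happ : (schrodingerOp V) ⟨G, hdom⟩ = (lp.single 2 y (1 : ℝ) : ℓ²(Zd d, ℝ)) :=
    lp.ext hfun
  have hrange : (lp.single 2 y (1 : ℝ) : ℓ²(Zd d, ℝ)) ∈ (schrodingerOp V).inverse.domain := by
    rw [LinearPMap.inverse_domain]
    exact ⟨⟨G, hdom⟩, happ⟩
  rw [green, dif_pos hrange, LinearPMap.inverse_apply_eq hker (x := ⟨G, hdom⟩) happ]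

theorem hamiltonian_green (ha : 0 < a) (hV : ∀ z, a ≤ V z) (x y : Zd d) :
    hamiltonian V (fun z => green V z y) x = if x = y then 1 else 0 := by
  obtain ⟨g, -, h1, -, h2⟩ := exists_summable_hamiltonian_eq ha hV y
  rw [funext (green_eq_of_hamiltonian_eq ha hV h1 h2)]
  exact h2 x

theorem green_nonneg (ha : 0 < a) (hV : ∀ z, a ≤ V z) (x y : Zd d) : 0 ≤ green V x y := by
  obtain ⟨g, h0, h1, -, h2⟩ := exists_summable_hamiltonian_eq ha hV y
  rw [green_eq_of_hamiltonian_eq ha hV h1 h2]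
  exact h0 x

theorem summable_green_left (ha : 0 < a) (hV : ∀ z, a ≤ V z) (y : Zd d) :
    Summable fun z => green V z y := by
  obtain ⟨g, -, h1, -, h2⟩ := exists_summable_hamiltonian_eq ha hV y
  rwa [funext (green_eq_of_hamiltonian_eq ha hV h1 h2)]

theorem tsum_green_left_le (ha : 0 < a) (hV : ∀ z, a ≤ V z) (y : Zd d) :
    ∑' z, green V z y ≤ 1 / a := by
  obtain ⟨g, -, h1, h3, h2⟩ := exists_summable_hamiltonian_eq ha hV y
  rwa [funext (green_eq_of_hamiltonian_eq ha hV h1 h2)]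

theorem green_le (ha : 0 < a) (hV : ∀ z, a ≤ V z) (x y : Zd d) : green V x y ≤ 1 / a :=
  ((summable_green_left ha hV y).le_tsum x fun z _ => green_nonneg ha hV z y).trans
    (tsum_green_left_le ha hV y)

theorem hasSum_green_mul_hamiltonian (ha : 0 < a) (hV : ∀ z, a ≤ V z) {g : Zd d → ℝ} {K : ℝ}
    (hg : ∀ x, |g x| ≤ K) (y : Zd d) :
    HasSum (fun z => green V z y * hamiltonian V g z) (g y) := by
  have h1 := hasSum_mul_hamiltonian_sub (summable_green_left ha hV y) hg V
  have h0 : ∀ x, hamiltonian V (fun z => green V z y) x = if x = y then 1 else 0 :=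
    fun x => hamiltonian_green ha hV x y
  rw [funext fun x => congrArg (fun t => green V x y * hamiltonian V g x - t * g x) (h0 x)] at h1
  have h2 : HasSum (fun z => (if z = y then 1 else 0) * g z) (g y) := by
    have := hasSum_ite_eq y (g y)
    convert this using 2 with z
    split_ifs with h <;> simp [h]
  simpa using h1.add h2

theorem abs_green_le (ha : 0 < a) (hV : ∀ z, a ≤ V z) (x y : Zd d) : |green V x y| ≤ 1 / a := by
  rw [abs_of_nonneg (green_nonneg ha hV x y)]
  exact green_le ha hV x y

theorem green_symm (ha : 0 < a) (hV : ∀ z, a ≤ V z) (x y : Zd d) : green V x y = green V y x := by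
  have h := hasSum_green_mul_hamiltonian ha hV (fun z => abs_green_le ha hV z x) y
  simp only [hamiltonian_green ha hV, mul_ite, mul_one, mul_zero] at h
  refine HasSum.unique ?_ h
  have := hasSum_ite_eq x (green V x y)
  convert this using 2 with z
  split_ifs with h <;> simp [h]

theorem summable_green_right (ha : 0 < a) (hV : ∀ z, a ≤ V z) (x : Zd d) :
    Summable fun z => green V x z := by
  simpa only [green_symm ha hV x] using summable_green_left ha hV x

theorem sum_green_right_le (ha : 0 < a) (hV : ∀ z, a ≤ V z) (x : Zd d) (B : Finset (Zd d)) :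
    ∑ z ∈ B, green V x z ≤ 1 / a := by
  simp only [green_symm ha hV x]
  exact ((summable_green_left ha hV x).sum_le_tsum B fun z _ => green_nonneg ha hV z x).trans
    (tsum_green_left_le ha hV x)

/-- The resolvent identity. -/
theorem hasSum_resolvent {V' : Zd d → ℝ} (ha : 0 < a) (hV : ∀ z, a ≤ V z) (hV' : ∀ z, a ≤ V' z)
    (x y : Zd d) :
    HasSum (fun z => green V x z * ((V z - V' z) * green V' z y))
      (green V' x y - green V x y) := by
  have h1 := hasSum_green_mul_hamiltonian ha hV (fun z => abs_green_le ha hV' z y) x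
  have h2 : ∀ z, hamiltonian V (fun z => green V' z y) z
      = (if z = y then 1 else 0) + (V z - V' z) * green V' z y := by
    intro z
    rw [← hamiltonian_green ha hV' z y, hamiltonian_eq, hamiltonian_eq]
    ring
  simp only [h2, green_symm ha hV _ x, mul_add] at h1
  have h3 : HasSum (fun z => green V x z * if z = y then 1 else 0) (green V x y) := by
    have := hasSum_ite_eq y (green V x y)
    convert this using 2 with z
    split_ifs with h <;> simp [h]
  simpa using h1.sub h3

theorem green_sub_green_eq_sum {V' : Zd d → ℝ} (ha : 0 < a) (hV : ∀ z, a ≤ V z)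
    (hV' : ∀ z, a ≤ V' z) {B : Finset (Zd d)} (hB : ∀ z ∉ B, V z = V' z) (x y : Zd d) :
    green V' x y - green V x y = ∑ z ∈ B, green V x z * ((V z - V' z) * green V' z y) :=
  (hasSum_resolvent ha hV hV' x y).unique
    (hasSum_sum_of_ne_finset_zero fun z hz => by rw [hB z hz]; simp)

theorem green_eq_add {V' : Zd d → ℝ} (ha : 0 < a) (hV : ∀ z, a ≤ V z)
    (hV' : ∀ z, a ≤ V' z) {z : Zd d} (hz : ∀ w ≠ z, V w = V' w) (x y : Zd d) :
    green V' x y = green V x y + (V z - V' z) * green V x z * green V' z y := by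
  have := green_sub_green_eq_sum ha hV hV' (B := {z}) (fun w hw => hz w (by simpa using hw)) x y
  rw [Finset.sum_singleton] at this
  linarith

/-- Dominated convergence in the resolvent identity, with the summable row `green V x ·` of the
limit as majorant. -/
theorem tendsto_green {Vn : ℕ → Zd d → ℝ} (ha : 0 < a) (hV : ∀ z, a ≤ V z ∧ V z ≤ b)
    (hVn : ∀ n z, a ≤ Vn n z ∧ Vn n z ≤ b)
    (h : ∀ z, Filter.Tendsto (fun n => Vn n z) Filter.atTop (nhds (V z))) (x y : Zd d) :
    Filter.Tendsto (fun n => green (Vn n) x y) Filter.atTop (nhds (green V x y)) := by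
  have e : ∀ n, green (Vn n) x y
      = green V x y + ∑' z, green V x z * ((V z - Vn n z) * green (Vn n) z y) := fun n => by
    rw [(hasSum_resolvent ha (fun z => (hV z).1) (fun z => (hVn n z).1) x y).tsum_eq]
    ring
  simp only [e]
  have h1 : Filter.Tendsto
      (fun n => ∑' z, green V x z * ((V z - Vn n z) * green (Vn n) z y)) Filter.atTop
      (nhds (∑' _ : Zd d, (0 : ℝ))) := by
    refine tendsto_tsum_of_dominated_convergence (bound := fun z => green V x z * ((b - a) * (1 / a)))
      ((summable_green_right ha (fun z => (hV z).1) x).mul_right _) (fun z => ?_)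
      (Filter.Eventually.of_forall fun n z => ?_)
    · have h2 : Filter.Tendsto (fun n => green V x z * (|V z - Vn n z| * (1 / a))) Filter.atTop
          (nhds (green V x z * (|V z - V z| * (1 / a)))) :=
        (((tendsto_const_nhds.sub (h z)).abs).mul_const _).const_mul _
      simp only [sub_self, abs_zero, zero_mul, mul_zero] at h2
      refine squeeze_zero_norm (fun n => ?_) h2
      rw [Real.norm_eq_abs, abs_mul, abs_mul, abs_of_nonneg (green_nonneg ha (fun z => (hV z).1) x z)]
      exact mul_le_mul_of_nonneg_left (mul_le_mul_of_nonneg_left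
        (abs_green_le ha (fun z => (hVn n z).1) z y) (abs_nonneg _))
        (green_nonneg ha (fun z => (hV z).1) x z)
    · rw [Real.norm_eq_abs, abs_mul, abs_mul, abs_of_nonneg (green_nonneg ha (fun z => (hV z).1) x z)]
      refine mul_le_mul_of_nonneg_left (mul_le_mul ?_
        (abs_green_le ha (fun z => (hVn n z).1) z y) (abs_nonneg _) ?_)
        (green_nonneg ha (fun z => (hV z).1) x z)
      · exact abs_le.2 ⟨by linarith [(hV z).1, (hVn n z).2], by linarith [(hV z).2, (hVn n z).1]⟩
      · linarith [(hV z).1, (hV z).2]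
  simpa using h1.const_add (green V x y)

/-- Walks from `x` to `y` that pass through `z` are only some of the walks from `x` to `y`. As
functions of `x` the two sides agree at `z`, and the maximum principle compares them elsewhere. -/
theorem green_mul_green_le (ha : 0 < a) (hV : ∀ z, a ≤ V z) (x y z : Zd d) :
    green V x z * green V z y ≤ green V x y * green V z z := by
  have hb : ∀ w, green V z y * green V w z - green V z z * green V w y ≤ 1 / a * (1 / a) := by
    intro w
    have h1 := mul_le_mul (green_le ha hV z y) (green_le ha hV w z) (green_nonneg ha hV w z)
      (by positivity)
    have h2 := mul_nonneg (green_nonneg ha hV z z) (green_nonneg ha hV w y)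
    linarith
  have := nonpos_of_hamiltonian_nonpos ha hV hb (fun w hw => ?_) x
  · linarith
  · rw [hamiltonian_sub, hamiltonian_const_mul, hamiltonian_const_mul, hamiltonian_green ha hV,
      hamiltonian_green ha hV]
    have hne : w ≠ z := by
      rintro rfl
      linarith
    rw [if_neg hne]
    have := green_nonneg ha hV z z
    split_ifs <;> linarith

theorem le_green_self (ha : 0 < a) (hV : ∀ z, a ≤ V z ∧ V z ≤ b) (y : Zd d) :
    1 / (1 + b) ≤ green V y y := by
  have hV' := fun z => (hV z).1
  have h := hamiltonian_green ha hV' y y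
  rw [if_pos rfl, hamiltonian_eq] at h
  have h1 := nbrAvg_nonneg (fun z => green_nonneg ha hV' z y) y
  have h2 := green_nonneg ha hV' y y
  have h3 := hV y
  rw [div_le_iff₀ (by linarith)]
  nlinarith

theorem one_le_harnackConst (hb : 0 < b) : 1 ≤ harnackConst d b := by
  have : (1 : ℝ) ≤ d := by exact_mod_cast NeZero.one_le
  unfold harnackConst
  nlinarith

theorem green_nbr_le (ha : 0 < a) (hV : ∀ z, a ≤ V z ∧ V z ≤ b) (x y : Zd d) (i : Fin d) :
    green V (x + Pi.single i 1) y ≤ harnackConst d b * green V x y ∧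
      green V (x - Pi.single i 1) y ≤ harnackConst d b * green V x y := by
  have hV' := fun z => (hV z).1
  have h := hamiltonian_green ha hV' x y
  rw [hamiltonian_eq] at h
  have h1 : nbrAvg (fun z => green V z y) x ≤ (1 + b) * green V x y := by
    have : (0 : ℝ) ≤ if x = y then 1 else 0 := by split_ifs <;> norm_num
    nlinarith [green_nonneg ha hV' x y, (hV x).2]
  have hd : (0 : ℝ) < d := Nat.cast_pos.2 (NeZero.pos d)
  rw [nbrAvg, one_div, inv_mul_le_iff₀ (by positivity)] at h1
  have h2 := Finset.single_le_sum (f := fun i : Fin d =>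
    green V (x + Pi.single i 1) y + green V (x - Pi.single i 1) y)
    (fun j _ => add_nonneg (green_nonneg ha hV' _ _) (green_nonneg ha hV' _ _)) (Finset.mem_univ i)
  have h3 := green_nonneg ha hV' (x + Pi.single i 1) y
  have h4 := green_nonneg ha hV' (x - Pi.single i 1) y
  rw [harnackConst, mul_assoc (2 * (d : ℝ))]
  constructor <;> linarith

/-- The Harnack inequality. -/
theorem green_le_harnack (ha : 0 < a) (hV : ∀ z, a ≤ V z ∧ V z ≤ b) (y : Zd d) :
    ∀ (n : ℕ) (x v : Zd d), natNorm v = n → green V (x + v) y ≤ harnackConst d b ^ n * green V x y := by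
  have hV' := fun z => (hV z).1
  have hb : 0 < b := ha.trans_le ((hV 0).1.trans (hV 0).2)
  have hK : 0 ≤ harnackConst d b := zero_le_one.trans (one_le_harnackConst hb)
  intro n
  induction n with
  | zero =>
    intro x v hv
    have : v = 0 := by
      funext i
      simpa using (Finset.sum_eq_zero_iff.1 hv) i (Finset.mem_univ i)
    simp [this]
  | succ n ih =>
    intro x v hv
    obtain ⟨i, hi⟩ : ∃ i, v i ≠ 0 := by
      by_contra! hc
      simp [natNorm, hc] at hv
    -- Moving a nonzero coordinate one unit towards `0`, with `s` its sign, lowers the norm by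
    -- exactly one.
    have step : ∀ s : ℤ, (v i - s).natAbs + 1 = (v i).natAbs →
        natNorm (v - Pi.single i s) = n := by
      intro s hs
      have e1 := Finset.add_sum_erase Finset.univ (fun j => (v j).natAbs) (Finset.mem_univ i)
      have e2 := Finset.add_sum_erase Finset.univ
        (fun j => ((v - Pi.single i s : Zd d) j).natAbs) (Finset.mem_univ i)
      have e3 : ∑ j ∈ Finset.univ.erase i, ((v - Pi.single i s : Zd d) j).natAbs
          = ∑ j ∈ Finset.univ.erase i, (v j).natAbs :=
        Finset.sum_congr rfl fun j hj => by simp [Finset.ne_of_mem_erase hj]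
      have e4 : (v - Pi.single i s : Zd d) i = v i - s := by simp
      rw [e4, e3] at e2
      unfold natNorm at hv ⊢
      omega
    rcases lt_or_gt_of_ne hi with h | h
    · have h1 := ih x (v - Pi.single i (-1)) (step (-1) (by omega))
      have h2 := (green_nbr_le ha hV (x + (v - Pi.single i (-1))) y i).2
      have e : x + (v - Pi.single i (-1)) - Pi.single i 1 = x + v := by
        rw [Pi.single_neg]; abel
      rw [e] at h2
      calc _ ≤ _ := h2
        _ ≤ harnackConst d b * (harnackConst d b ^ n * green V x y) :=
          mul_le_mul_of_nonneg_left h1 hK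
        _ = _ := by ring
    · have h1 := ih x (v - Pi.single i 1) (step 1 (by omega))
      have h2 := (green_nbr_le ha hV (x + (v - Pi.single i 1)) y i).1
      have e : x + (v - Pi.single i 1) + Pi.single i 1 = x + v := by abel
      rw [e] at h2
      calc _ ≤ _ := h2
        _ ≤ harnackConst d b * (harnackConst d b ^ n * green V x y) :=
          mul_le_mul_of_nonneg_left h1 hK
        _ = _ := by ring

theorem green_le_pow_mul (ha : 0 < a) (hV : ∀ z, a ≤ V z ∧ V z ≤ b) (x x' y : Zd d) :
    green V x' y ≤ harnackConst d b ^ natNorm (x' - x) * green V x y := by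
  simpa using green_le_harnack ha hV y _ x (x' - x) rfl

theorem le_green (ha : 0 < a) (hV : ∀ z, a ≤ V z ∧ V z ≤ b) (x y : Zd d) :
    1 / (1 + b) / harnackConst d b ^ natNorm (y - x) ≤ green V x y := by
  have hb : 0 < b := ha.trans_le ((hV 0).1.trans (hV 0).2)
  have hK : 0 < harnackConst d b := zero_lt_one.trans_le (one_le_harnackConst hb)
  rw [div_le_iff₀' (by positivity)]
  exact (le_green_self ha hV y).trans (green_le_pow_mul ha hV x y y)

theorem green_pos (ha : 0 < a) (hV : ∀ z, a ≤ V z ∧ V z ≤ b) (x y : Zd d) : 0 < green V x y := by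
  have hb : 0 < b := ha.trans_le ((hV 0).1.trans (hV 0).2)
  have hK : 0 < harnackConst d b := zero_lt_one.trans_le (one_le_harnackConst hb)
  exact lt_of_lt_of_le (by positivity) (le_green ha hV x y)

theorem green_translate (ha : 0 < a) (hV : ∀ z, a ≤ V z) (w x y : Zd d) :
    green (fun z => V (z + w)) x y = green V (x + w) (y + w) := by
  refine green_eq_of_hamiltonian_eq (V := fun z => V (z + w)) ha (fun z => hV _)
    (g := fun x => green V (x + w) (y + w)) ?_ (fun x => ?_) x
  · exact (hasSum_comp_add (summable_green_left ha hV (y + w)).hasSum w).summable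
  · have h := hamiltonian_green ha hV (x + w) (y + w)
    simp only [add_left_inj] at h
    rw [← h]
    simp only [hamiltonian, add_right_comm x _ w, add_sub_right_comm]

end Anderson

/-! ### Time spent by the conditioned walk, and sensitivity of `ρ` to the potential. -/

namespace Anderson

variable {d : ℕ}

/-- The expected time spent at `z` by the random walk from `x` to `y` in the potential `V`. -/
noncomputable def tau (V : Zd d → ℝ) (z x y : Zd d) : ℝ := green V x z * green V z y / green V x y

variable [NeZero d] {V : Zd d → ℝ} {a b : ℝ}

theorem tau_nonneg (ha : 0 < a) (hV : ∀ z, a ≤ V z ∧ V z ≤ b) (z x y : Zd d) : 0 ≤ tau V z x y :=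
  div_nonneg (mul_nonneg (green_pos ha hV x z).le (green_pos ha hV z y).le) (green_pos ha hV x y).le

theorem tau_le (ha : 0 < a) (hV : ∀ z, a ≤ V z ∧ V z ≤ b) (z x y : Zd d) :
    tau V z x y ≤ 1 / a := by
  rw [tau, div_le_iff₀ (green_pos ha hV x y), mul_comm (1 / a)]
  exact (green_mul_green_le ha (fun z => (hV z).1) x y z).trans
    (mul_le_mul_of_nonneg_left (green_le ha (fun z => (hV z).1) z z) (green_pos ha hV x y).le)

theorem sum_tau_le_card (ha : 0 < a) (hV : ∀ z, a ≤ V z ∧ V z ≤ b) (B : Finset (Zd d))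
    (x y : Zd d) : ∑ z ∈ B, tau V z x y ≤ B.card * (1 / a) := by
  rw [← nsmul_eq_mul]
  exact Finset.sum_le_card_nsmul B _ _ fun z _ => tau_le ha hV z x y

/-- The potential `V`, lowered by `s` on `B`. -/
noncomputable def lowered (V : Zd d → ℝ) (B : Finset (Zd d)) (s : ℝ) (z : Zd d) : ℝ :=
  V z - if z ∈ B then s else 0

omit [NeZero d] in
theorem le_lowered (ha : 0 < a) (hV : ∀ z, a ≤ V z) (B : Finset (Zd d)) (z : Zd d) :
    a / 2 ≤ lowered V B (a / 2) z := by
  have := hV z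
  unfold lowered
  split_ifs <;> linarith

omit [NeZero d] in
theorem hamiltonian_lowered (B : Finset (Zd d)) (s : ℝ) (f : Zd d → ℝ) (x : Zd d) :
    hamiltonian (lowered V B s) f x = hamiltonian V f x - (if x ∈ B then s else 0) * f x := by
  rw [hamiltonian_eq, hamiltonian_eq, lowered]
  ring

/-- Convexity in the killing rate: the time spent in `B` is controlled by the effect of lowering
the potential on `B`. -/
theorem exp_sum_tau_mul_green_le (ha : 0 < a) (hV : ∀ z, a ≤ V z ∧ V z ≤ b) (B : Finset (Zd d))
    (x y : Zd d) :
    Real.exp (a / 2 * ∑ z ∈ B, tau V z x y) * green V x y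
      ≤ green (lowered V B (a / 2)) x y := by
  have hV' := fun z => (hV z).1
  set s := a / 2 with hs
  have hs0 : 0 < s := by positivity
  set h : Zd d → ℝ := fun x => green V x y with hh
  -- With `t` the time spent in `B`, `g = t * h` solves `H g = 1_B h`.
  set g : Zd d → ℝ := fun x => ∑ z ∈ B, green V z y * green V x z with hg
  set t : Zd d → ℝ := fun x => ∑ z ∈ B, tau V z x y with ht
  have hpos : ∀ x, 0 < h x := fun x => green_pos ha hV x y
  have hgt : ∀ x, g x = t x * h x := by
    intro x
    simp only [hg, ht, Finset.sum_mul]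
    refine Finset.sum_congr rfl fun z _ => ?_
    rw [tau, div_mul_cancel₀ _ (hpos x).ne', mul_comm]
  have hHh : ∀ x, hamiltonian V h x = if x = y then 1 else 0 := fun x =>
    hamiltonian_green ha hV' x y
  have hHg : ∀ x, hamiltonian V g x = if x ∈ B then h x else 0 := by
    intro x
    rw [hg, hamiltonian_finset_sum]
    have : ∀ z ∈ B, hamiltonian V (fun x => green V z y * green V x z) x
        = if x = z then h z else 0 := fun z _ => by
      rw [hamiltonian_const_mul, hamiltonian_green ha hV']
      split_ifs <;> simp [hh]
    rw [Finset.sum_congr rfl this, Finset.sum_ite_eq]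
  refine le_of_hamiltonian_le (V := lowered V B s) (a := s) hs0 (le_lowered ha hV' B)
    (u := fun x => Real.exp (s * t x) * h x) (v := fun x => green (lowered V B s) x y)
    -- The comparison principle needs an a priori upper bound; finiteness of `B` supplies this one,
    -- and its size is irrelevant.
    (K := Real.exp (s * (B.card * (1 / a))) * (1 / a)) (fun x => ?_) (fun x => ?_) x
  · have h1 : Real.exp (s * t x) ≤ Real.exp (s * (B.card * (1 / a))) :=
      Real.exp_le_exp.2 (mul_le_mul_of_nonneg_left (sum_tau_le_card ha hV B x y) hs0.le)
    have h2 := mul_le_mul h1 (green_le ha hV' x y) (hpos x).le (Real.exp_pos _).le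
    have h3 := green_nonneg hs0 (le_lowered ha hV' B) x y
    simp only [hh]
    linarith
  · rw [hamiltonian_green hs0 (le_lowered ha hV' B)]
    set p := Real.exp (s * t x) with hp
    have hp0 : 0 < p := Real.exp_pos _
    -- The tangent line of the exponential at `s * t x`, times `h`. It lies below `exp (s * t) * h`
    -- and touches it at `x`, so its Hamiltonian at `x` is the larger one; off `y` that Hamiltonian
    -- vanishes at `x`, and at `y` it is at most `1` by `1 - u ≤ exp (-u)`.
    set ψ : Zd d → ℝ := fun w => p * ((1 - s * t x) * h w - -s * g w) with hψ
    have h1 : ∀ w, ψ w ≤ Real.exp (s * t w) * h w := by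
      intro w
      have h2 : p * (1 + (s * t w - s * t x)) ≤ Real.exp (s * t w) := by
        have h3 := Real.add_one_le_exp (s * t w - s * t x)
        calc _ ≤ p * Real.exp (s * t w - s * t x) :=
              mul_le_mul_of_nonneg_left (by linarith) hp0.le
          _ = _ := by rw [hp, ← Real.exp_add]; ring_nf
      calc ψ w = p * (1 + (s * t w - s * t x)) * h w := by simp only [hψ, hgt w]; ring
        _ ≤ _ := mul_le_mul_of_nonneg_right h2 (hpos w).le
    have h4 : hamiltonian (lowered V B s) (fun x => Real.exp (s * t x) * h x) x
        ≤ hamiltonian (lowered V B s) ψ x := by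
      rw [hamiltonian_eq, hamiltonian_eq]
      have h5 : ψ x = Real.exp (s * t x) * h x := by simp only [hψ, hgt x, hp]; ring
      rw [h5]
      exact sub_le_sub_left (nbrAvg_mono h1 x) _
    refine h4.trans ?_
    have h6 : hamiltonian (lowered V B s) ψ x = p * (1 - s * t x) * if x = y then 1 else 0 := by
      rw [hψ, hamiltonian_const_mul, hamiltonian_sub, hamiltonian_const_mul, hamiltonian_const_mul,
        hamiltonian_lowered, hamiltonian_lowered, hHh, hHg, hgt]
      by_cases hx : x ∈ B <;> simp only [hx, if_true, if_false] <;> ring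
    rw [h6]
    refine mul_le_of_le_one_left (by split_ifs <;> norm_num) ?_
    have h7 := mul_le_mul_of_nonneg_left (Real.one_sub_le_exp_neg (s * t x)) hp0.le
    rwa [hp, ← Real.exp_add, add_neg_cancel, Real.exp_zero] at h7

/-- Logarithms turn exponential growth of the Green function under lowering into a linear bound on
time. -/
theorem sum_tau_le_of_green_lowered_le (ha : 0 < a) (hV : ∀ z, a ≤ V z ∧ V z ≤ b)
    (B : Finset (Zd d)) (x y : Zd d) {c K : ℝ} {n : ℕ} (hc : 1 ≤ c) (hK : 1 ≤ K)
    (h : green (lowered V B (a / 2)) x y ≤ c * K ^ n * green V x y) :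
    ∑ z ∈ B, tau V z x y ≤ 2 / a * (Real.log c + Real.log K) * (1 + n) := by
  have h1 := le_of_mul_le_mul_right ((exp_sum_tau_mul_green_le ha hV B x y).trans h)
    (green_pos ha hV x y)
  have h2 := (Real.le_log_iff_exp_le (by positivity)).2 h1
  rw [Real.log_mul (by positivity) (by positivity), Real.log_pow] at h2
  have h3 : 0 ≤ Real.log c := Real.log_nonneg hc
  have h4 : 0 ≤ Real.log K := Real.log_nonneg hK
  have h5 : a / 2 * ∑ z ∈ B, tau V z x y ≤ (Real.log c + Real.log K) * (1 + n) := by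
    nlinarith [Nat.cast_nonneg (α := ℝ) n]
  calc _ = 2 / a * (a / 2 * ∑ z ∈ B, tau V z x y) := by field_simp
    _ ≤ 2 / a * ((Real.log c + Real.log K) * (1 + n)) :=
      mul_le_mul_of_nonneg_left h5 (by positivity)
    _ = _ := by ring

/-- The total time spent by the walk is at most linear in the distance. -/
theorem exists_sum_tau_le (d : ℕ) [NeZero d] (ha : 0 < a) (hab : a < b) :
    ∃ C, 0 < C ∧ ∀ V : Zd d → ℝ, (∀ z, a ≤ V z ∧ V z ≤ b) → ∀ (B : Finset (Zd d)) (x y : Zd d),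
      ∑ z ∈ B, tau V z x y ≤ C * (1 + natNorm (y - x)) := by
  have hb : 0 < b := ha.trans hab
  have hK := one_le_harnackConst (d := d) hb
  have hc : 1 < 2 * (1 + b) / a := by
    rw [lt_div_iff₀ ha]
    linarith
  refine ⟨2 / a * (Real.log (2 * (1 + b) / a) + Real.log (harnackConst d b)), ?_, ?_⟩
  · have := Real.log_pos hc
    have := Real.log_nonneg hK
    positivity
  intro V hV B x y
  refine sum_tau_le_of_green_lowered_le ha hV B x y hc.le hK ?_
  have h1 := green_le (half_pos ha) (le_lowered ha (fun z => (hV z).1) B) x y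
  have h2 := le_green ha hV x y
  have h3 : 0 < harnackConst d b := by linarith
  rw [div_le_iff₀ (by positivity), div_le_iff₀ (by positivity)] at h2
  calc _ ≤ 1 / (a / 2) := h1
    _ = 2 / a * 1 := by field_simp
    _ ≤ 2 / a * (green V x y * harnackConst d b ^ natNorm (y - x) * (1 + b)) :=
      mul_le_mul_of_nonneg_left h2 (by positivity)
    _ = _ := by ring

/-- The time spent in a set of diameter `D` is at most linear in `D`. -/
theorem exists_sum_tau_le_of_diam (d : ℕ) [NeZero d] (ha : 0 < a) (hab : a < b) :
    ∃ C, 0 < C ∧ ∀ V : Zd d → ℝ, (∀ z, a ≤ V z ∧ V z ≤ b) → ∀ (B : Finset (Zd d)) (D : ℕ),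
      (∀ v ∈ B, ∀ w ∈ B, natNorm (v - w) ≤ D) → (B.card : ℝ) ≤ harnackConst d b ^ D →
      ∀ x y : Zd d, ∑ z ∈ B, tau V z x y ≤ C * (1 + D) := by
  have hb : 0 < b := ha.trans hab
  set K := harnackConst d b with hKdef
  have hK : 1 ≤ K := one_le_harnackConst (d := d) hb
  refine ⟨2 / a * (Real.log 2 + Real.log (K ^ 2)), ?_, ?_⟩
  · have := Real.log_pos one_lt_two
    have := Real.log_nonneg (one_le_pow₀ (n := 2) hK)
    positivity
  intro V hV B D hD hcard x y
  refine sum_tau_le_of_green_lowered_le ha hV B x y one_le_two (one_le_pow₀ hK) ?_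
  have hV' := fun z => (hV z).1
  have hW := le_lowered ha hV' B
  have hs := half_pos ha
  have hVs : ∀ z, a / 2 ≤ V z := fun z => by linarith [hV' z]
  have hoff : ∀ z ∉ B, V z = lowered V B (a / 2) z := fun z hz => by simp [lowered, hz]
  have hon : ∀ z ∈ B, V z - lowered V B (a / 2) z = a / 2 := fun z hz => by simp [lowered, hz]
  have hKD : 1 ≤ K ^ D := one_le_pow₀ hK
  -- From a point of `B`, Harnack compares every `green V z y` with `green V w y`. The row sum of
  -- the lowered Green function is at most `2 / a`, which cancels the perturbation `a / 2`, so the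
  -- cardinality of `B` does not enter here.
  have h1 : ∀ w ∈ B, green (lowered V B (a / 2)) w y ≤ 2 * K ^ D * green V w y := by
    intro w hw
    have e := green_sub_green_eq_sum hs hW hVs (fun z hz => (hoff z hz).symm) w y
    have hG := green_pos ha hV w y
    have e2 : -∑ z ∈ B, green (lowered V B (a / 2)) w z *
        ((lowered V B (a / 2) z - V z) * green V z y) ≤ K ^ D * green V w y := by
      rw [← Finset.sum_neg_distrib]
      calc _ ≤ ∑ z ∈ B, green (lowered V B (a / 2)) w z * (a / 2 * (K ^ D * green V w y)) := by
            refine Finset.sum_le_sum fun z hz => ?_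
            rw [← mul_neg, ← neg_mul, neg_sub, hon z hz]
            refine mul_le_mul_of_nonneg_left (mul_le_mul_of_nonneg_left ?_ hs.le)
              (green_nonneg hs hW w z)
            exact (green_le_pow_mul ha hV w z y).trans
              (mul_le_mul_of_nonneg_right (pow_le_pow_right₀ hK (hD z hz w hw)) hG.le)
        _ ≤ 1 / (a / 2) * (a / 2 * (K ^ D * green V w y)) := by
            rw [← Finset.sum_mul]
            exact mul_le_mul_of_nonneg_right (sum_green_right_le hs hW w B) (by positivity)
        _ = _ := by field_simp
    nlinarith
  have e := green_sub_green_eq_sum hs hVs hW hoff x y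
  have hG := green_pos ha hV x y
  -- For arbitrary `x` the crude bound `B.card / a` on the time suffices: the cardinality becomes
  -- one more factor `K ^ D`.
  have e2 : ∑ z ∈ B, green V x z * ((V z - lowered V B (a / 2) z) *
      green (lowered V B (a / 2)) z y) ≤ K ^ D * K ^ D * green V x y := by
    calc _ ≤ ∑ z ∈ B, a * K ^ D * green V x y * tau V z x y := by
          refine Finset.sum_le_sum fun z hz => ?_
          rw [hon z hz]
          calc _ ≤ green V x z * (a / 2 * (2 * K ^ D * green V z y)) :=
                mul_le_mul_of_nonneg_left (mul_le_mul_of_nonneg_left (h1 z hz) hs.le)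
                  (green_pos ha hV x z).le
            _ = _ := by rw [tau]; field_simp
      _ ≤ a * K ^ D * green V x y * (B.card * (1 / a)) := by
          rw [← Finset.mul_sum]
          exact mul_le_mul_of_nonneg_left (sum_tau_le_card ha hV B x y) (by positivity)
      _ = K ^ D * B.card * green V x y := by field_simp
      _ ≤ _ := by gcongr
  have e3 : (K ^ 2) ^ D = K ^ D * K ^ D := by rw [← pow_mul, mul_comm, pow_mul, sq]
  rw [e3]
  nlinarith [one_le_mul_of_one_le_of_one_le hKD hKD]

theorem rho_eq (ha : 0 < a) (hV : ∀ z, a ≤ V z ∧ V z ≤ b) (x y : Zd d) :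
    rho V x y = (Real.log (green V x x) + Real.log (green V y y)) / 2
      - Real.log (green V x y) := by
  have h1 := green_pos ha hV x x
  have h2 := green_pos ha hV y y
  rw [rho, Real.log_div (Real.sqrt_pos.2 (mul_pos h1 h2)).ne' (green_pos ha hV x y).ne',
    Real.log_sqrt (mul_pos h1 h2).le, Real.log_mul h1.ne' h2.ne']

/-- The effect on the Green function of changing the potential at one site. -/
theorem exists_abs_log_green_sub_le (d : ℕ) [NeZero d] (ha : 0 < a) (hab : a < b) :
    ∃ C, 0 < C ∧ ∀ V V' : Zd d → ℝ, (∀ z, a ≤ V z ∧ V z ≤ b) → (∀ z, a ≤ V' z ∧ V' z ≤ b) →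
      ∀ z, (∀ w ≠ z, V w = V' w) → ∀ x y,
        |Real.log (green V x y) - Real.log (green V' x y)| ≤ C * tau V z x y := by
  set K := 1 + (b - a) / a with hK
  have hK0 : 0 < K := by
    have : 0 < (b - a) / a := div_pos (by linarith) ha
    linarith
  have hba : 0 < b - a := by linarith
  -- Starting at the modified site, the resolvent identity costs only a constant because `green V' z
  -- z ≤ 1 / a`. This replaces `V'` by `V` in the general identity.
  have single : ∀ V V' : Zd d → ℝ, (∀ z, a ≤ V z ∧ V z ≤ b) → (∀ z, a ≤ V' z ∧ V' z ≤ b) →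
      ∀ z, (∀ w ≠ z, V w = V' w) → ∀ y, green V' z y ≤ K * green V z y := by
    intro V V' hV hV' z hz y
    have e := green_eq_add ha (fun z => (hV' z).1) (fun z => (hV z).1) (fun w hw => (hz w hw).symm)
      z y
    have h1 := green_pos ha hV z y
    have h2 : (V z - V' z) * green V' z z ≤ (b - a) * (1 / a) :=
      mul_le_mul (by linarith [(hV z).2, (hV' z).1]) (green_le ha (fun z => (hV' z).1) z z)
        (green_pos ha hV' z z).le hba.le
    have h3 := mul_le_mul_of_nonneg_right h2 h1.le
    rw [hK]
    calc _ = green V z y + (V z - V' z) * green V' z z * green V z y := by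
          linear_combination -e
      _ ≤ green V z y + (b - a) * (1 / a) * green V z y := by linarith
      _ = _ := by ring
  have upper : ∀ V V' : Zd d → ℝ, (∀ z, a ≤ V z ∧ V z ≤ b) → (∀ z, a ≤ V' z ∧ V' z ≤ b) →
      ∀ z, (∀ w ≠ z, V w = V' w) → ∀ x y,
        green V' x y ≤ green V x y * (1 + (b - a) * K * tau V z x y) := by
    intro V V' hV hV' z hz x y
    have e := green_eq_add ha (fun z => (hV z).1) (fun z => (hV' z).1) hz x y
    have h1 := green_pos ha hV x z
    have h2 : (V z - V' z) * (green V x z * green V' z y)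
        ≤ (b - a) * (green V x z * (K * green V z y)) := by
      refine mul_le_mul (by linarith [(hV z).2, (hV' z).1])
        (mul_le_mul_of_nonneg_left (single V V' hV hV' z hz y) h1.le)
        (mul_pos h1 (green_pos ha hV' z y)).le hba.le
    calc _ = green V x y + (V z - V' z) * (green V x z * green V' z y) := by rw [e]; ring
      _ ≤ green V x y + (b - a) * (green V x z * (K * green V z y)) := by linarith
      _ = _ := by
        rw [tau]
        have := (green_pos ha hV x y).ne'
        field_simp
  have logle : ∀ V V' : Zd d → ℝ, (∀ z, a ≤ V z ∧ V z ≤ b) → (∀ z, a ≤ V' z ∧ V' z ≤ b) →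
      ∀ z, (∀ w ≠ z, V w = V' w) → ∀ x y,
        Real.log (green V' x y) - Real.log (green V x y) ≤ (b - a) * K * tau V z x y := by
    intro V V' hV hV' z hz x y
    have ht : 0 ≤ (b - a) * K * tau V z x y :=
      mul_nonneg (by positivity) (tau_nonneg ha hV z x y)
    have h1 := Real.log_le_log (green_pos ha hV' x y) (upper V V' hV hV' z hz x y)
    rw [Real.log_mul (green_pos ha hV x y).ne' (by positivity)] at h1
    linarith [Real.log_le_sub_one_of_pos (show 0 < 1 + (b - a) * K * tau V z x y by positivity)]
  -- One direction of the estimate involves `tau V'` instead of `tau V`. The Green functions are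
  -- comparable within a factor `L`, hence the times within `L ^ 3`.
  set L := 1 + (b - a) * K * (1 / a) with hL
  have hL1 : 1 ≤ L := by
    have : 0 ≤ (b - a) * K * (1 / a) := by positivity
    linarith
  have whole : ∀ V V' : Zd d → ℝ, (∀ z, a ≤ V z ∧ V z ≤ b) → (∀ z, a ≤ V' z ∧ V' z ≤ b) →
      ∀ z, (∀ w ≠ z, V w = V' w) → ∀ x y, green V' x y ≤ L * green V x y := by
    intro V V' hV hV' z hz x y
    refine (upper V V' hV hV' z hz x y).trans ?_
    rw [mul_comm]
    refine mul_le_mul_of_nonneg_right ?_ (green_pos ha hV x y).le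
    exact add_le_add le_rfl (mul_le_mul_of_nonneg_left (tau_le ha hV z x y) (by positivity))
  have comp : ∀ V V' : Zd d → ℝ, (∀ z, a ≤ V z ∧ V z ≤ b) → (∀ z, a ≤ V' z ∧ V' z ≤ b) →
      ∀ z, (∀ w ≠ z, V w = V' w) → ∀ x y, tau V' z x y ≤ L ^ 3 * tau V z x y := by
    intro V V' hV hV' z hz x y
    have hz' := fun w hw => (hz w hw).symm
    have h1 := whole V V' hV hV' z hz x z
    have h2 := whole V V' hV hV' z hz z y
    have h3 := whole V' V hV' hV z hz' x y
    have p1 := green_pos ha hV x y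
    have p2 := green_pos ha hV' x y
    have p3 := green_pos ha hV x z
    have p4 := green_pos ha hV z y
    have p5 := green_pos ha hV' z y
    rw [tau, tau, div_le_iff₀ p2]
    calc _ ≤ (L * green V x z) * (L * green V z y) :=
          mul_le_mul h1 h2 p5.le (by positivity)
      _ = L ^ 2 * (green V x z * green V z y / green V x y) * green V x y := by field_simp
      _ ≤ L ^ 2 * (green V x z * green V z y / green V x y) * (L * green V' x y) :=
          mul_le_mul_of_nonneg_left h3 (by positivity)
      _ = _ := by ring
  refine ⟨(b - a) * K * L ^ 3, by positivity, fun V V' hV hV' z hz x y => abs_le.2 ⟨?_, ?_⟩⟩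
  · have h1 := logle V V' hV hV' z hz x y
    have h2 : (b - a) * K * tau V z x y ≤ (b - a) * K * L ^ 3 * tau V z x y :=
      mul_le_mul_of_nonneg_right (le_mul_of_one_le_right (by positivity) (one_le_pow₀ hL1))
        (tau_nonneg ha hV z x y)
    linarith
  · have h1 := logle V' V hV' hV z (fun w hw => (hz w hw).symm) x y
    have h2 := mul_le_mul_of_nonneg_left (comp V V' hV hV' z hz x y)
      (show 0 ≤ (b - a) * K by positivity)
    linarith

/-- The sum of the times that control the effect on `ρ(x, y)` of a change of the potential
at `z`. -/
noncomputable def influence (V : Zd d → ℝ) (z x y : Zd d) : ℝ :=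
  tau V z x y + tau V z x x + tau V z y y

theorem influence_nonneg (ha : 0 < a) (hV : ∀ z, a ≤ V z ∧ V z ≤ b) (z x y : Zd d) :
    0 ≤ influence V z x y :=
  add_nonneg (add_nonneg (tau_nonneg ha hV _ _ _) (tau_nonneg ha hV _ _ _)) (tau_nonneg ha hV _ _ _)

theorem influence_le (ha : 0 < a) (hV : ∀ z, a ≤ V z ∧ V z ≤ b) (z x y : Zd d) :
    influence V z x y ≤ 3 / a := by
  have h := fun x y => tau_le ha hV z x y
  have := h x y
  have := h x x
  have := h y y
  rw [influence, show 3 / a = 1 / a + 1 / a + 1 / a by ring]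
  linarith

theorem exists_sum_influence_le (d : ℕ) [NeZero d] (ha : 0 < a) (hab : a < b) :
    ∃ C, 0 < C ∧ ∀ V : Zd d → ℝ, (∀ z, a ≤ V z ∧ V z ≤ b) → ∀ (B : Finset (Zd d)) (x y : Zd d),
      ∑ z ∈ B, influence V z x y ≤ C * (1 + natNorm (y - x)) := by
  obtain ⟨C, hC, h⟩ := exists_sum_tau_le d ha hab
  refine ⟨3 * C, by positivity, fun V hV B x y => ?_⟩
  simp only [influence, Finset.sum_add_distrib]
  have h1 := h V hV B x y
  have h2 := h V hV B x x
  have h3 := h V hV B y y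
  simp only [sub_self, show natNorm (0 : Zd d) = 0 by simp [natNorm], Nat.cast_zero] at h2 h3
  have : 0 ≤ C * (natNorm (y - x) : ℝ) := by positivity
  linarith

theorem exists_sum_influence_le_of_diam (d : ℕ) [NeZero d] (ha : 0 < a) (hab : a < b) :
    ∃ C, 0 < C ∧ ∀ V : Zd d → ℝ, (∀ z, a ≤ V z ∧ V z ≤ b) → ∀ (B : Finset (Zd d)) (D : ℕ),
      (∀ v ∈ B, ∀ w ∈ B, natNorm (v - w) ≤ D) → (B.card : ℝ) ≤ harnackConst d b ^ D →
      ∀ x y : Zd d, ∑ z ∈ B, influence V z x y ≤ C * (1 + D) := by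
  obtain ⟨C, hC, h⟩ := exists_sum_tau_le_of_diam d ha hab
  refine ⟨3 * C, by positivity, fun V hV B D hD hB x y => ?_⟩
  simp only [influence, Finset.sum_add_distrib]
  have h1 := h V hV B D hD hB
  linarith [h1 x y, h1 x x, h1 y y]

theorem exists_abs_rho_sub_le (d : ℕ) [NeZero d] (ha : 0 < a) (hab : a < b) :
    ∃ C, 0 < C ∧ ∀ V V' : Zd d → ℝ, (∀ z, a ≤ V z ∧ V z ≤ b) → (∀ z, a ≤ V' z ∧ V' z ≤ b) →
      ∀ z, (∀ w ≠ z, V w = V' w) → ∀ x y,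
        |rho V x y - rho V' x y| ≤ C * influence V z x y := by
  obtain ⟨C, hC, h⟩ := exists_abs_log_green_sub_le d ha hab
  refine ⟨C, hC, fun V V' hV hV' z hz x y => ?_⟩
  rw [rho_eq ha hV, rho_eq ha hV', influence]
  have h1 := abs_le.1 (h V V' hV hV' z hz x y)
  have h2 := abs_le.1 (h V V' hV hV' z hz x x)
  have h3 := abs_le.1 (h V V' hV hV' z hz y y)
  rw [abs_le]
  constructor <;> linarith [h1.1, h1.2, h2.1, h2.2, h3.1, h3.2]

theorem abs_log_green_sub_le (ha : 0 < a) (hV : ∀ z, a ≤ V z ∧ V z ≤ b) (x x' y : Zd d) :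
    |Real.log (green V x y) - Real.log (green V x' y)|
      ≤ natNorm (x' - x) * Real.log (harnackConst d b) := by
  have hb : 0 < b := ha.trans_le ((hV 0).1.trans (hV 0).2)
  have hK : 0 < harnackConst d b := zero_lt_one.trans_le (one_le_harnackConst hb)
  have key : ∀ x x', Real.log (green V x' y)
      ≤ natNorm (x' - x) * Real.log (harnackConst d b) + Real.log (green V x y) := by
    intro x x'
    have := Real.log_le_log (green_pos ha hV x' y) (green_le_pow_mul ha hV x x' y)
    rwa [Real.log_mul (by positivity) (green_pos ha hV x y).ne', Real.log_pow] at this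
  have h1 := key x x'
  have h2 := key x' x
  rw [show natNorm (x - x') = natNorm (x' - x) from
    Finset.sum_congr rfl fun i _ => by simp only [Pi.sub_apply]; omega] at h2
  rw [abs_le]
  constructor <;> linarith

/-- `ρ` is Lipschitz in both of its arguments. -/
theorem abs_rho_sub_le (ha : 0 < a) (hV : ∀ z, a ≤ V z ∧ V z ≤ b) (x y x' y' : Zd d) :
    |rho V x y - rho V x' y'|
      ≤ 2 * (natNorm (x' - x) + natNorm (y' - y)) * Real.log (harnackConst d b) := by
  have hs := green_symm ha fun z => (hV z).1
  rw [rho_eq ha hV, rho_eq ha hV]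
  -- The diagonal entry at `x` is carried to `x'` one argument at a time, using the symmetry of
  -- `green`.
  have h1 := abs_le.1 (abs_log_green_sub_le ha hV x x' x)
  have h2 := abs_le.1 (abs_log_green_sub_le ha hV x x' x')
  have h3 := abs_le.1 (abs_log_green_sub_le ha hV y y' y)
  have h4 := abs_le.1 (abs_log_green_sub_le ha hV y y' y')
  have h5 := abs_le.1 (abs_log_green_sub_le ha hV x x' y)
  have h6 := abs_le.1 (abs_log_green_sub_le ha hV y y' x')
  rw [hs x' x] at h1
  rw [hs y' y] at h3
  rw [hs y x', hs y' x'] at h6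
  rw [abs_le]
  constructor <;> linarith [h1.1, h1.2, h2.1, h2.2, h3.1, h3.2, h4.1, h4.2, h5.1, h5.2, h6.1, h6.2]

theorem rho_self (ha : 0 < a) (hV : ∀ z, a ≤ V z ∧ V z ≤ b) (x : Zd d) : rho V x x = 0 := by
  rw [rho_eq ha hV]
  ring

theorem rho_translate (ha : 0 < a) (hV : ∀ z, a ≤ V z) (w x y : Zd d) :
    rho (fun z => V (z + w)) x y = rho V (x + w) (y + w) := by
  simp only [rho, green_translate ha hV]

theorem tendsto_rho {Vn : ℕ → Zd d → ℝ} (ha : 0 < a) (hV : ∀ z, a ≤ V z ∧ V z ≤ b)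
    (hVn : ∀ n z, a ≤ Vn n z ∧ Vn n z ≤ b)
    (h : ∀ z, Filter.Tendsto (fun n => Vn n z) Filter.atTop (nhds (V z))) (x y : Zd d) :
    Filter.Tendsto (fun n => rho (Vn n) x y) Filter.atTop (nhds (rho V x y)) := by
  have hlog : ∀ x y, Filter.Tendsto (fun n => Real.log (green (Vn n) x y)) Filter.atTop
      (nhds (Real.log (green V x y))) := fun x y =>
    (tendsto_green ha hV hVn h x y).log (green_pos ha hV x y).ne'
  rw [rho_eq ha hV]
  simp only [rho_eq ha (hVn _)]
  exact (((hlog x x).add (hlog y y)).div_const 2).sub (hlog x y)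

end Anderson

/-! ### Law of the random set of `b`-sites, and averaging over shifts. -/

namespace Cube

section Law

variable {ι Ω : Type*} {V : ι → Ω → ℝ} {b : ℝ}

open Classical in
/-- The sites of `Λ` at which `V` takes the value `b`. -/
noncomputable def sites (V : ι → Ω → ℝ) (b : ℝ) (Λ : Finset ι) (ω : Ω) : Finset ι :=
  {z ∈ Λ | V z ω = b}

theorem mem_sites {Λ : Finset ι} {ω : Ω} {z : ι} : z ∈ sites V b Λ ω ↔ z ∈ Λ ∧ V z ω = b := by
  simp [sites]

theorem sites_subset (Λ : Finset ι) (ω : Ω) : sites V b Λ ω ⊆ Λ := fun _ h => (mem_sites.1 h).1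

variable [DecidableEq ι]

theorem setOf_sites_eq {Λ T : Finset ι} (hT : T ⊆ Λ) :
    {ω | sites V b Λ ω = T} = ⋂ z ∈ Λ, V z ⁻¹' (if z ∈ T then {b} else {b}ᶜ) := by
  ext ω
  simp only [Set.mem_ofPred_eq, Set.mem_iInter, Set.mem_preimage, Finset.ext_iff, mem_sites]
  refine forall_congr' fun z => ?_
  by_cases hz : z ∈ T
  · simp [hz, hT hz]
  · simp [hz]

theorem comp_sites_eq_sum (g : Finset ι → ℝ) (Λ : Finset ι) :
    (fun ω => g (sites V b Λ ω))
      = fun ω => ∑ T ∈ Λ.powerset, {ω | sites V b Λ ω = T}.indicator (fun _ => g T) ω := by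
  funext ω
  simp only [Set.indicator_apply, Set.mem_ofPred_eq]
  rw [Finset.sum_ite_eq, if_pos (Finset.mem_powerset.2 (sites_subset Λ ω))]

variable [MeasurableSpace Ω] {μ : Measure Ω}

theorem measurableSet_sites_eq (hm : ∀ z, Measurable (V z)) {Λ T : Finset ι} (hT : T ⊆ Λ) :
    MeasurableSet {ω | sites V b Λ ω = T} := by
  rw [setOf_sites_eq hT]
  refine Finset.measurableSet_biInter _ fun z _ => hm z ?_
  split_ifs
  · exact measurableSet_singleton b
  · exact (measurableSet_singleton b).compl

theorem measureReal_sites_eq [IsProbabilityMeasure μ] (hm : ∀ z, Measurable (V z))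
    (hi : iIndepFun V μ) (hb : ∀ z, μ {ω | V z ω = b} = 1 / 2) {Λ T : Finset ι} (hT : T ⊆ Λ) :
    μ.real {ω | sites V b Λ ω = T} = 1 / 2 ^ Λ.card := by
  have h1 : ∀ z, μ (V z ⁻¹' (if z ∈ T then {b} else {b}ᶜ)) = 1 / 2 := by
    intro z
    have h2 : μ (V z ⁻¹' {b}) = 1 / 2 := hb z
    split_ifs
    · exact h2
    · rw [Set.preimage_compl, prob_compl_eq_one_sub (hm z (measurableSet_singleton b)), h2]
      simp
  have h3 := (iIndepFun_iff_measure_inter_preimage_eq_mul.1 hi) Λ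
    (sets := fun z => if z ∈ T then {b} else {b}ᶜ) fun z _ => by
      split_ifs
      · exact measurableSet_singleton b
      · exact (measurableSet_singleton b).compl
  rw [setOf_sites_eq hT, Measure.real, h3, Finset.prod_congr rfl fun z _ => h1 z,
    Finset.prod_const]
  simp

theorem measurable_comp_sites (hm : ∀ z, Measurable (V z)) (g : Finset ι → ℝ) (Λ : Finset ι) :
    Measurable fun ω => g (sites V b Λ ω) := by
  rw [comp_sites_eq_sum]
  exact Finset.measurable_fun_sum _ fun T hT =>
    measurable_const.indicator (measurableSet_sites_eq hm (Finset.mem_powerset.1 hT))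

theorem integral_comp_sites [IsProbabilityMeasure μ] (hm : ∀ z, Measurable (V z))
    (hi : iIndepFun V μ) (hb : ∀ z, μ {ω | V z ω = b} = 1 / 2) (g : Finset ι → ℝ) (Λ : Finset ι) :
    ∫ ω, g (sites V b Λ ω) ∂μ = avg Λ g := by
  have hs : ∀ T ∈ Λ.powerset, MeasurableSet {ω | sites V b Λ ω = T} := fun T hT =>
    measurableSet_sites_eq hm (Finset.mem_powerset.1 hT)
  rw [comp_sites_eq_sum, integral_finsetSum _ fun T hT => (integrable_const _).indicator (hs T hT)]
  rw [avg, Finset.sum_div]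
  refine Finset.sum_congr rfl fun T hT => ?_
  rw [integral_indicator_const _ (hs T hT),
    measureReal_sites_eq hm hi hb (Finset.mem_powerset.1 hT), smul_eq_mul]
  ring

end Law

section Shift

variable {ι : Type*} [DecidableEq ι] [AddCommGroup ι]

/-- The part in `Λ` of the set `T`, shifted by `-w`. -/
def shift (Λ : Finset ι) (w : ι) (T : Finset ι) : Finset ι := {u ∈ Λ | u + w ∈ T}

/-- Flipping `z` in `T` flips `z - w` in the shifted set, or changes nothing when that point falls
outside `Λ`. -/
theorem grad_shift (Λ : Finset ι) (R : Finset ι → ℝ) (z w : ι) (T : Finset ι) :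
    grad z (fun T => R (shift Λ w T)) T
      = if z - w ∈ Λ then grad (z - w) R (shift Λ w T) else 0 := by
  have hz : ∀ u, u + w = z ↔ u = z - w := fun u => eq_sub_iff_add_eq.symm
  split_ifs with h
  · have : shift Λ w (symmDiff T {z}) = symmDiff (shift Λ w T) {z - w} := by
      ext u
      simp only [shift, Finset.mem_filter, Finset.mem_symmDiff, Finset.mem_singleton, hz]
      by_cases hu : u = z - w
      · subst hu
        simp [h]
      · simp [hu]
    rw [grad, grad, this]
  · have : shift Λ w (symmDiff T {z}) = shift Λ w T := by
      ext u
      simp only [shift, Finset.mem_filter, Finset.mem_symmDiff, Finset.mem_singleton, hz]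
      by_cases hu : u = z - w
      · subst hu
        simp [h]
      · simp [hu]
    rw [grad, this]
    simp

/-- The average of a function on the cube over shifts. -/
noncomputable def shiftAvg (Λ B : Finset ι) (R : Finset ι → ℝ) (T : Finset ι) : ℝ :=
  (∑ w ∈ B, R (shift Λ w T)) / B.card

theorem grad_shiftAvg (Λ B : Finset ι) (R : Finset ι → ℝ) (z : ι) (T : Finset ι) :
    grad z (shiftAvg Λ B R) T
      = (∑ w ∈ B, grad z (fun T => R (shift Λ w T)) T) / B.card := by
  simp only [grad, shiftAvg, ← Finset.sum_div, Finset.sum_sub_distrib]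
  ring

/-- Averaging over the shifts by the elements of `B` makes all influences small, which improves
the bound on the variance. -/
theorem variance_shiftAvg_le {Λ Λ' B : Finset ι} (hB : B.Nonempty) {R : Finset ι → ℝ}
    {q : ι → Finset ι → ℝ} {M L E : ℝ} (k : ℕ)
    (hshift : ∀ w ∈ B, ∀ g : Finset ι → ℝ, avg Λ' (fun T => g (shift Λ w T)) = avg Λ g)
    (hq0 : ∀ u T, 0 ≤ q u T) (hR : ∀ u T, |grad u R T| ≤ q u T) (hM : ∀ u T, q u T ≤ M)
    (hL : ∀ S T, ∑ u ∈ S, q u T ≤ L) (hE : ∀ z T, ∑ w ∈ B, q (z - w) T ≤ E) :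
    avg Λ' (fun T => shiftAvg Λ B R T ^ 2) - avg Λ' (shiftAvg Λ B R) ^ 2
      ≤ (M / (k + 1) + 4 ^ k * √(M * (E / B.card))) * L := by
  have hc : (0 : ℝ) < B.card := Nat.cast_pos.2 hB.card_pos
  have hM0 : 0 ≤ M := (hq0 0 ∅).trans (hM 0 ∅)
  set p : ι → ι → Finset ι → ℝ :=
    fun z w T => if z - w ∈ Λ then q (z - w) (shift Λ w T) else 0 with hp
  have hgrad : ∀ z T, |grad z (shiftAvg Λ B R) T| ≤ (∑ w ∈ B, p z w T) / B.card := by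
    intro z T
    rw [grad_shiftAvg, abs_div, abs_of_pos hc]
    refine div_le_div_of_nonneg_right ?_ hc.le
    refine (Finset.abs_sum_le_sum_abs _ _).trans (Finset.sum_le_sum fun w _ => ?_)
    rw [grad_shift]
    simp only [hp]
    split_ifs
    · exact hR _ _
    · simp
  have hsum : ∑ z ∈ Λ', avg Λ' (fun T => |grad z (shiftAvg Λ B R) T|) ≤ L := by
    rw [← avg_sum, ← avg_const Λ' L]
    refine avg_mono fun T _ => ?_
    calc _ ≤ ∑ z ∈ Λ', (∑ w ∈ B, p z w T) / B.card := Finset.sum_le_sum fun z _ => hgrad z T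
      _ = (∑ w ∈ B, ∑ z ∈ Λ', p z w T) / B.card := by rw [← Finset.sum_div, Finset.sum_comm]
      _ ≤ (B.card • L) / B.card := by
          refine div_le_div_of_nonneg_right (Finset.sum_le_card_nsmul _ _ _ fun w _ => ?_) hc.le
          calc _ ≤ ∑ z ∈ Λ', q (z - w) (shift Λ w T) := Finset.sum_le_sum fun z _ => by
                simp only [hp]
                split_ifs
                · exact le_rfl
                · exact hq0 _ _
            -- For a fixed shift, the sites `z - w` are distinct, so averaging does not increase the
            -- total influence.
            _ = ∑ u ∈ Λ'.image (· - w), q u (shift Λ w T) := by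
                rw [Finset.sum_image fun _ _ _ _ h => sub_left_injective h]
            _ ≤ L := hL _ _
      _ = L := by rw [nsmul_eq_mul, mul_div_cancel_left₀ _ hc.ne']
  refine (variance_le Λ' _ k hM0 (fun z _ T _ => ?_) fun z _ => ?_).trans
    (mul_le_mul_of_nonneg_left hsum (by positivity))
  · refine (hgrad z T).trans ?_
    rw [div_le_iff₀ hc, mul_comm, ← nsmul_eq_mul]
    refine Finset.sum_le_card_nsmul _ _ _ fun w _ => ?_
    simp only [hp]
    split_ifs
    · exact hM _ _
    · exact hM0
  · calc _ ≤ avg Λ' (fun T => (B.card : ℝ)⁻¹ * ∑ w ∈ B, p z w T) :=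
          avg_mono fun T _ => (hgrad z T).trans_eq (div_eq_inv_mul _ _)
      _ = (B.card : ℝ)⁻¹ * ∑ w ∈ B, avg Λ' (p z w) := by rw [avg_const_mul, avg_sum]
      -- All shifted sets have the same law. In expectation, shifting the set is thus traded for
      -- moving the site, and the sum over `w` becomes a sum over `z - B` in one environment.
      _ ≤ (B.card : ℝ)⁻¹ * ∑ w ∈ B, avg Λ (q (z - w)) := by
          refine mul_le_mul_of_nonneg_left (Finset.sum_le_sum fun w hw => ?_) (by positivity)
          rw [← hshift w hw]
          refine avg_mono fun T _ => ?_
          simp only [hp]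
          split_ifs
          · exact le_rfl
          · exact hq0 _ _
      _ ≤ (B.card : ℝ)⁻¹ * E := by
          refine mul_le_mul_of_nonneg_left ?_ (by positivity)
          rw [← avg_sum, ← avg_const Λ E]
          exact avg_mono fun T _ => hE z T
      _ = _ := (div_eq_inv_mul _ _).symm

end Shift

end Cube

/-! ### Limits and perturbations of variances, and the choice of scales. -/

section Limits

variable {Ω : Type*} [MeasurableSpace Ω] {μ : Measure Ω} [IsProbabilityMeasure μ]

theorem variance_le_of_tendsto {f : ℕ → Ω → ℝ} {g : Ω → ℝ} {K c : ℝ}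
    (hf : ∀ n, AEStronglyMeasurable (f n) μ) (hK : ∀ n ω, |f n ω| ≤ K)
    (h : ∀ᵐ ω ∂μ, Filter.Tendsto (fun n => f n ω) Filter.atTop (nhds (g ω)))
    (hc : ∀ n, ∫ ω, f n ω ^ 2 ∂μ - (∫ ω, f n ω ∂μ) ^ 2 ≤ c) :
    MemLp g 2 μ ∧ Var[g; μ] ≤ c := by
  have hg : AEStronglyMeasurable g μ := aestronglyMeasurable_of_tendsto_ae _ hf h
  have hgK : ∀ᵐ ω ∂μ, ‖g ω‖ ≤ K := by
    filter_upwards [h] with ω hω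
    exact le_of_tendsto' hω.norm fun n => hK n ω
  have hmem : MemLp g 2 μ := MemLp.of_bound hg K hgK
  refine ⟨hmem, ?_⟩
  rw [variance_eq_sub hmem]
  have h1 : Filter.Tendsto (fun n => ∫ ω, f n ω ∂μ) Filter.atTop (nhds (∫ ω, g ω ∂μ)) :=
    tendsto_integral_of_dominated_convergence (fun _ => K) hf (integrable_const K)
      (fun n => Filter.Eventually.of_forall (hK n)) h
  have h2 : Filter.Tendsto (fun n => ∫ ω, f n ω ^ 2 ∂μ) Filter.atTop
      (nhds (∫ ω, g ω ^ 2 ∂μ)) := by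
    refine tendsto_integral_of_dominated_convergence (fun _ => K ^ 2) (fun n => (hf n).pow 2)
      (integrable_const _) (fun n => Filter.Eventually.of_forall fun ω => ?_) ?_
    · rw [norm_pow]
      exact pow_le_pow_left₀ (norm_nonneg _) (hK n ω) 2
    · filter_upwards [h] with ω hω using hω.pow 2
  exact le_of_tendsto' (h2.sub (h1.pow 2)) hc

theorem variance_le_of_abs_sub_le {X Y : Ω → ℝ} {r : ℝ} (hX : MemLp X 2 μ) (hY : MemLp Y 2 μ)
    (h : ∀ᵐ ω ∂μ, |X ω - Y ω| ≤ r) : Var[X; μ] ≤ 2 * Var[Y; μ] + 2 * r ^ 2 := by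
  rw [← variance_sub_const hX.aestronglyMeasurable μ[Y]]
  refine (variance_le_expectation_sq (hX.aestronglyMeasurable.sub aestronglyMeasurable_const)).trans ?_
  rw [variance_eq_integral hY.aemeasurable]
  have hint : Integrable (fun ω => (Y ω - μ[Y]) ^ 2) μ :=
    (hY.sub (memLp_const _)).integrable_sq
  calc _ ≤ ∫ ω, (2 * (Y ω - μ[Y]) ^ 2 + 2 * r ^ 2) ∂μ := by
        refine integral_mono_ae (hX.sub (memLp_const _)).integrable_sq
          ((hint.const_mul 2).add (integrable_const _)) ?_
        filter_upwards [h] with ω hω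
        have h1 : (X ω - Y ω) ^ 2 ≤ r ^ 2 := sq_le_sq' (abs_le.1 hω).1 (abs_le.1 hω).2
        change (X ω - μ[Y]) ^ 2 ≤ _
        nlinarith [sq_nonneg ((X ω - Y ω) - (Y ω - μ[Y]))]
    _ = _ := by
        rw [integral_add (hint.const_mul 2) (integrable_const _), integral_const_mul]
        simp

end Limits

/-- The parameters of the averaging argument at distance `N`. -/
theorem exists_scales {N : ℕ} (hN : 1 ≤ N) :
    ∃ m k : ℕ, 1 ≤ m ∧ (m : ℝ) ^ 2 ≤ N / (k + 1) ∧ (4 : ℝ) ^ k / √m ≤ 1 / (k + 1) ∧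
      Real.log (N + 2) ≤ 5 * Real.log 256 * (k + 1) := by
  -- Here `m` is about `N ^ (1/4)`, and base `256` is chosen so that `4 ^ k * (k + 1) ≤ 16 ^ k ≤
  -- √m`.
  set s := Nat.sqrt N
  set m := Nat.sqrt s
  set k := Nat.log 256 m
  have hm : 1 ≤ m := Nat.sqrt_pos.2 (Nat.sqrt_pos.2 hN)
  have h1 : m ^ 4 ≤ N := by
    calc m ^ 4 = (m ^ 2) ^ 2 := by ring
      _ ≤ s ^ 2 := Nat.pow_le_pow_left (Nat.sqrt_le' s) 2
      _ ≤ N := Nat.sqrt_le' N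
  have h2 : N ≤ (m + 1) ^ 4 := by
    calc N ≤ (s + 1) ^ 2 := (Nat.lt_succ_sqrt' N).le
      _ ≤ ((m + 1) ^ 2) ^ 2 := Nat.pow_le_pow_left (Nat.lt_succ_sqrt' s) 2
      _ = _ := by ring
  have h3 : 256 ^ k ≤ m := Nat.pow_log_le_self 256 (by omega)
  have h4 : m + 1 ≤ 256 ^ (k + 1) := Nat.lt_pow_succ_log_self (by norm_num) m
  have hk : ∀ c : ℕ, 1 < c → k + 1 ≤ c ^ k := fun c hc => Nat.lt_pow_self hc
  refine ⟨m, k, hm, ?_, ?_, ?_⟩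
  · rw [le_div_iff₀ (by positivity)]
    have : m ^ 2 * (k + 1) ≤ N := by
      calc m ^ 2 * (k + 1) ≤ m ^ 2 * m :=
            Nat.mul_le_mul_left _ ((hk 256 (by norm_num)).trans h3)
        _ = m ^ 3 := by ring
        _ ≤ m ^ 4 := Nat.pow_le_pow_right hm (by norm_num)
        _ ≤ N := h1
    exact_mod_cast this
  · have hm0 : (0 : ℝ) < m := by exact_mod_cast hm
    have h5 : (16 : ℝ) ^ k ≤ √m := by
      refine Real.le_sqrt_of_sq_le ?_
      rw [← pow_mul, mul_comm, pow_mul]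
      norm_num
      exact_mod_cast h3
    rw [div_le_div_iff₀ (Real.sqrt_pos.2 hm0) (by positivity), one_mul]
    refine le_trans ?_ h5
    have : (k : ℝ) + 1 ≤ 4 ^ k := by exact_mod_cast hk 4 (by norm_num)
    calc (4 : ℝ) ^ k * (k + 1) ≤ 4 ^ k * 4 ^ k := by gcongr
      _ = 16 ^ k := by rw [← mul_pow]; norm_num
  · have h5 : N + 2 ≤ 256 ^ (5 * (k + 1)) := by
      calc N + 2 ≤ 256 * N := by omega
        _ ≤ 256 ^ (k + 1) * (256 ^ (k + 1)) ^ 4 := by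
            refine Nat.mul_le_mul ?_ (h2.trans (Nat.pow_le_pow_left h4 4))
            exact Nat.le_self_pow (by omega) 256
        _ = _ := by ring
    calc Real.log (N + 2) ≤ Real.log (256 ^ (5 * (k + 1))) :=
          Real.log_le_log (by positivity) (by exact_mod_cast h5)
      _ = _ := by rw [Real.log_pow]; push_cast; ring

/-! ### The variance bound for `ρ` in finite environments. -/

namespace Anderson

variable {d : ℕ}

/-- The potential equal to `b` on `T` and to `a` elsewhere. -/
noncomputable def env (a b : ℝ) (T : Finset (Zd d)) (z : Zd d) : ℝ := if z ∈ T then b else a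

theorem env_mem {a b : ℝ} (hab : a < b) (T : Finset (Zd d)) (z : Zd d) :
    a ≤ env a b T z ∧ env a b T z ≤ b := by
  unfold env
  split_ifs
  · exact ⟨hab.le, le_rfl⟩
  · exact ⟨le_rfl, hab.le⟩

theorem env_symmDiff (a b : ℝ) (T : Finset (Zd d)) {z w : Zd d} (h : w ≠ z) :
    env a b T w = env a b (symmDiff T {z}) w := by
  simp [env, Finset.mem_symmDiff, h]

theorem natNorm_add_le (x y : Zd d) : natNorm (x + y) ≤ natNorm x + natNorm y := by
  rw [natNorm, natNorm, natNorm, ← Finset.sum_add_distrib]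
  exact Finset.sum_le_sum fun i _ => Int.natAbs_add_le _ _

theorem natNorm_single (i : Fin d) (s : ℤ) : natNorm (Pi.single i s : Zd d) = s.natAbs := by
  rw [natNorm, Finset.sum_eq_single_of_mem i (Finset.mem_univ i)]
  · simp
  · intro j _ hj
    simp [hj]

/-- A two-dimensional square in `ℤ^d`. -/
theorem exists_square (hd : 2 ≤ d) (m : ℕ) :
    ∃ B : Finset (Zd d), B.card = m ^ 2 ∧ (∀ w ∈ B, natNorm w ≤ 2 * m) ∧
      ∀ v ∈ B, ∀ w ∈ B, natNorm (v - w) ≤ 2 * m := by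
  let e₀ : Fin d := ⟨0, by omega⟩
  let e₁ : Fin d := ⟨1, by omega⟩
  have hne : e₀ ≠ e₁ := by simp [e₀, e₁]
  let f : ℕ × ℕ → Zd d := fun p => Pi.single e₀ (p.1 : ℤ) + Pi.single e₁ (p.2 : ℤ)
  have h0 : ∀ p, f p e₀ = p.1 := fun p => by simp [f, hne]
  have h1 : ∀ p, f p e₁ = p.2 := fun p => by simp [f, hne.symm]
  have hf : Function.Injective f := by
    intro p q h
    have h2 := congrFun h e₀
    have h3 := congrFun h e₁
    rw [h0, h0] at h2
    rw [h1, h1] at h3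
    exact Prod.ext (by exact_mod_cast h2) (by exact_mod_cast h3)
  have hsub : ∀ p q, f p - f q
      = Pi.single e₀ ((p.1 : ℤ) - q.1) + Pi.single e₁ ((p.2 : ℤ) - q.2) := by
    intro p q
    simp only [f, Pi.single_sub]
    abel
  refine ⟨(Finset.range m ×ˢ Finset.range m).image f, ?_, ?_, ?_⟩
  · rw [Finset.card_image_of_injective _ hf, Finset.card_product, Finset.card_range, sq]
  · intro w hw
    obtain ⟨p, hp, rfl⟩ := Finset.mem_image.1 hw
    rw [Finset.mem_product, Finset.mem_range, Finset.mem_range] at hp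
    refine (natNorm_add_le _ _).trans ?_
    rw [natNorm_single, natNorm_single]
    omega
  · intro v hv w hw
    obtain ⟨p, hp, rfl⟩ := Finset.mem_image.1 hv
    obtain ⟨q, hq, rfl⟩ := Finset.mem_image.1 hw
    rw [Finset.mem_product, Finset.mem_range, Finset.mem_range] at hp hq
    rw [hsub]
    refine (natNorm_add_le _ _).trans ?_
    rw [natNorm_single, natNorm_single]
    omega

theorem abs_rho_le [NeZero d] {V : Zd d → ℝ} {a b : ℝ} (ha : 0 < a)
    (hV : ∀ z, a ≤ V z ∧ V z ≤ b) (x : Zd d) :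
    |rho V 0 x| ≤ 2 * natNorm x * Real.log (harnackConst d b) := by
  have h := abs_rho_sub_le ha hV 0 x x x
  simpa [rho_self ha hV, natNorm] using h

/-- The variance bound on the cube, for the average of `ρ` over shifts. -/
theorem exists_variance_shiftAvg_rho_le (hd : 2 ≤ d) {a b : ℝ} (ha : 0 < a) (hab : a < b) :
    ∃ C, 0 < C ∧ ∀ (x : Zd d) (m k : ℕ) (B Λ Λ' : Finset (Zd d)), 1 ≤ natNorm x → 1 ≤ m →
      (4 : ℝ) ^ k / √m ≤ 1 / (k + 1) → B.card = m ^ 2 →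
      (∀ v ∈ B, ∀ w ∈ B, natNorm (v - w) ≤ 2 * m) →
      (∀ w ∈ B, ∀ g : Finset (Zd d) → ℝ,
        Cube.avg Λ' (fun T => g (Cube.shift Λ w T)) = Cube.avg Λ g) →
      Cube.avg Λ' (fun T => Cube.shiftAvg Λ B (fun T => rho (env a b T) 0 x) T ^ 2)
        - Cube.avg Λ' (Cube.shiftAvg Λ B fun T => rho (env a b T) 0 x) ^ 2
        ≤ C * (natNorm x / (k + 1)) := by
  have : NeZero d := ⟨by omega⟩
  obtain ⟨C₀, hC₀, hrho⟩ := exists_abs_rho_sub_le d ha hab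
  obtain ⟨C₁, hC₁, htot⟩ := exists_sum_influence_le d ha hab
  obtain ⟨C₂, hC₂, hloc⟩ := exists_sum_influence_le_of_diam d ha hab
  set M := C₀ * (3 / a) with hM
  have hM0 : 0 < M := by positivity
  -- The `3` comes from `1 + 2 * m ≤ 3 * m`, the `2` from `1 + natNorm x ≤ 2 * natNorm x`.
  refine ⟨(M + √(M * (3 * C₀ * C₂))) * (2 * C₀ * C₁), by positivity, ?_⟩
  intro x m k B Λ Λ' hx hm hk hcard hdiam hshift
  have hV := fun T => env_mem (d := d) hab T
  have hm1 : (1 : ℝ) ≤ m := by exact_mod_cast hm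
  have hx1 : (1 : ℝ) ≤ natNorm x := by exact_mod_cast hx
  have hB : B.Nonempty := Finset.card_pos.1 (by rw [hcard]; positivity)
  have hK := four_le_harnackConst hd (ha.trans hab)
  have key := Cube.variance_shiftAvg_le (Λ := Λ) (Λ' := Λ') hB
    (R := fun T => rho (env a b T) 0 x)
    (q := fun u T => C₀ * influence (env a b T) u 0 x) (M := M)
    (L := C₀ * (C₁ * (1 + natNorm x))) (E := C₀ * (C₂ * (1 + (2 * m : ℕ)))) k hshift
    (fun u T => mul_nonneg hC₀.le (influence_nonneg ha (hV T) u 0 x))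
    (fun u T => ?_) (fun u T => mul_le_mul_of_nonneg_left (influence_le ha (hV T) u 0 x) hC₀.le)
    (fun S T => ?_) (fun z T => ?_)
  · refine key.trans ?_
    have h1 : √(M * (C₀ * (C₂ * (1 + (2 * m : ℕ))) / B.card)) ≤ √(M * (3 * C₀ * C₂)) / √m := by
      rw [← Real.sqrt_div (by positivity)]
      refine Real.sqrt_le_sqrt ?_
      rw [hcard, mul_div_assoc M (3 * C₀ * C₂)]
      refine mul_le_mul_of_nonneg_left ?_ hM0.le
      rw [div_le_div_iff₀ (by positivity) (by positivity)]
      push_cast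
      have : C₀ * C₂ * m * (1 + 2 * m) ≤ C₀ * C₂ * m * (3 * m) := by
        refine mul_le_mul_of_nonneg_left ?_ (by positivity)
        linarith
      nlinarith
    have h2 : M / (k + 1) + 4 ^ k * √(M * (C₀ * (C₂ * (1 + (2 * m : ℕ))) / B.card))
        ≤ (M + √(M * (3 * C₀ * C₂))) * (1 / (k + 1)) := by
      calc _ ≤ M / (k + 1) + 4 ^ k * (√(M * (3 * C₀ * C₂)) / √m) := by gcongr
        _ = M * (1 / (k + 1)) + √(M * (3 * C₀ * C₂)) * (4 ^ k / √m) := by ring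
        _ ≤ M * (1 / (k + 1)) + √(M * (3 * C₀ * C₂)) * (1 / (k + 1)) := by gcongr
        _ = _ := by ring
    calc _ ≤ (M + √(M * (3 * C₀ * C₂))) * (1 / (k + 1)) * (C₀ * (C₁ * (2 * natNorm x))) := by
          refine mul_le_mul h2 ?_ (by positivity) (by positivity)
          gcongr
          linarith
      _ = _ := by ring
  · have h := hrho _ _ (hV T) (hV (symmDiff T {u})) u (fun w hw => env_symmDiff a b T hw) 0 x
    simp only [Cube.grad]
    rw [abs_div, abs_two]
    have := abs_nonneg (rho (env a b T) 0 x - rho (env a b (symmDiff T {u})) 0 x)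
    linarith
  · simp only [← Finset.mul_sum]
    have := htot _ (hV T) S 0 x
    rw [sub_zero] at this
    exact mul_le_mul_of_nonneg_left this hC₀.le
  · simp only [← Finset.mul_sum]
    refine mul_le_mul_of_nonneg_left ?_ hC₀.le
    -- The reflected square `z - B` has the diameter and cardinality of `B`, so the local time bound
    -- applies to it.
    have hinj : Function.Injective fun w : Zd d => z - w := sub_right_injective
    rw [← Finset.sum_image (f := fun u => influence (env a b T) u 0 x) fun _ _ _ _ h => hinj h]
    refine hloc _ (hV T) _ _ ?_ ?_ 0 x
    · intro v hv w hw
      obtain ⟨v', hv', rfl⟩ := Finset.mem_image.1 hv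
      obtain ⟨w', hw', rfl⟩ := Finset.mem_image.1 hw
      rw [sub_sub_sub_cancel_left]
      exact hdiam w' hw' v' hv'
    · rw [Finset.card_image_of_injective _ hinj, hcard]
      have h1 : m ≤ 4 ^ m := (Nat.lt_pow_self (by norm_num)).le
      calc ((m ^ 2 : ℕ) : ℝ) ≤ ((4 ^ m) ^ 2 : ℕ) := by exact_mod_cast Nat.pow_le_pow_left h1 2
        _ = 4 ^ (2 * m) := by push_cast; rw [← pow_mul, mul_comm]
        _ ≤ _ := pow_le_pow_left₀ (by norm_num) hK _

end Anderson

/-! ### The random environment and the conclusion. -/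

section Environment

open Anderson

/-- The boxes that exhaust `ℤ^d`. -/
noncomputable def box (d n : ℕ) : Finset (Zd d) := Finset.Icc (fun _ => -(n : ℤ)) fun _ => (n : ℤ)

theorem eventually_mem_box {d : ℕ} (z : Zd d) : ∀ᶠ n in Filter.atTop, z ∈ box d n := by
  filter_upwards [Filter.eventually_ge_atTop (Anderson.natNorm z)] with n hn
  have h : ∀ i, (z i).natAbs ≤ n := fun i =>
    (Finset.single_le_sum (f := fun i => (z i).natAbs) (fun _ _ => Nat.zero_le _)
      (Finset.mem_univ i)).trans hn
  rw [box, Finset.mem_Icc]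
  exact ⟨fun i => by have := h i; simp only; omega, fun i => by have := h i; simp only; omega⟩

/-- Approximation of `ρ` by functions of finitely many values of the potential. -/
theorem tendsto_rho_env_sites {d : ℕ} [NeZero d] {a b : ℝ} {Ω : Type*} {V : Zd d → Ω → ℝ} (ha : 0 < a) (hab : a < b) {ω : Ω}
    (hω : ∀ z, V z ω = a ∨ V z ω = b) (w x : Zd d) :
    Filter.Tendsto
      (fun n => rho (env a b (Cube.sites (fun z => V (z + w)) b (box d n) ω)) 0 x) Filter.atTop
      (nhds (rho (fun z => V z ω) w (x + w))) := by
  have hV : ∀ z, a ≤ V z ω ∧ V z ω ≤ b := fun z => by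
    rcases hω z with h | h <;> rw [h] <;> constructor <;> linarith
  have h := rho_translate ha (fun z => (hV z).1) w 0 x
  rw [zero_add] at h
  rw [← h]
  refine tendsto_rho ha (fun z => hV (z + w)) (fun n => env_mem hab _) (fun z => ?_) 0 x
  refine tendsto_const_nhds.congr' ?_
  filter_upwards [eventually_mem_box z] with n hn
  rw [env]
  rcases hω (z + w) with h | h
  · have hz : z ∉ Cube.sites (fun z => V (z + w)) b (box d n) ω := fun hc =>
      hab.ne (h.symm.trans (Cube.mem_sites.1 hc).2)
    rw [if_neg hz, h]
  · have hz : z ∈ Cube.sites (fun z => V (z + w)) b (box d n) ω := Cube.mem_sites.2 ⟨hn, h⟩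
    rw [if_pos hz, h]

theorem shift_sites {d : ℕ} {b : ℝ} {Ω : Type*} {V : Zd d → Ω → ℝ} {Λ Λ' : Finset (Zd d)} {w : Zd d} (h : ∀ u ∈ Λ, u + w ∈ Λ') (ω : Ω) :
    Cube.shift Λ w (Cube.sites V b Λ' ω) = Cube.sites (fun z => V (z + w)) b Λ ω := by
  ext u
  simp only [Cube.shift, Finset.mem_filter, Cube.mem_sites]
  exact ⟨fun hu => ⟨hu.1, hu.2.2⟩, fun hu => ⟨hu.1, h u hu.1, hu.2⟩⟩

variable {d : ℕ} {a b : ℝ} {Ω : Type*} [MeasurableSpace Ω] {μ : Measure Ω} [IsProbabilityMeasure μ]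
  {V : Zd d → Ω → ℝ}

theorem ae_forall_eq_or_eq (hab : a < b) (hm : ∀ x, Measurable (V x))
    (hp : ∀ x, μ {ω | V x ω = a} = 1 / 2 ∧ μ {ω | V x ω = b} = 1 / 2) :
    ∀ᵐ ω ∂μ, ∀ z, V z ω = a ∨ V z ω = b := by
  refine ae_all_iff.2 fun z => ?_
  have hms : ∀ c, MeasurableSet {ω | V z ω = c} := fun c => hm z (measurableSet_singleton c)
  have hdis : Disjoint {ω | V z ω = a} {ω | V z ω = b} :=
    Set.disjoint_left.2 fun ω h1 h2 => hab.ne (h1.symm.trans h2)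
  have h1 : μ ({ω | V z ω = a} ∪ {ω | V z ω = b}) = 1 := by
    rw [measure_union hdis (hms b), (hp z).1, (hp z).2, ENNReal.add_halves]
  exact (mem_ae_iff_prob_eq_one ((hms a).union (hms b))).2 h1

/-- Both averages are expectations over the random field, one through `V` and the other through its
translate by `w`, which is again independent and unbiased. -/
theorem avg_shift (hm : ∀ x, Measurable (V x)) (hi : iIndepFun V μ)
    (hb : ∀ x, μ {ω | V x ω = b} = 1 / 2) {Λ Λ' : Finset (Zd d)} {w : Zd d}
    (h : ∀ u ∈ Λ, u + w ∈ Λ') (g : Finset (Zd d) → ℝ) :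
    Cube.avg Λ' (fun T => g (Cube.shift Λ w T)) = Cube.avg Λ g := by
  rw [← Cube.integral_comp_sites hm hi hb]
  simp only [shift_sites h]
  exact Cube.integral_comp_sites (fun z => hm (z + w))
    (hi.precomp (add_left_injective w)) (fun z => hb (z + w)) g Λ

end Environment

open Anderson

theorem theorem2 (d : ℕ) (hd : 2 ≤ d) (a b : ℝ) (ha : 0 < a) (hab : a < b) :
    ∃ C : ℝ, 0 < C ∧
      ∀ (Ω : Type*) [MeasurableSpace Ω] (μ : Measure Ω) [IsProbabilityMeasure μ]
        (V : Zd d → Ω → ℝ),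
        (∀ x, Measurable (V x)) →
        iIndepFun V μ →
        (∀ x, μ {ω | V x ω = a} = 1 / 2 ∧ μ {ω | V x ω = b} = 1 / 2) →
        ∀ x : Zd d,
          MemLp (fun ω => Anderson.rho (fun z => V z ω) 0 x) 2 μ ∧
          Var[fun ω => Anderson.rho (fun z => V z ω) 0 x; μ]
            ≤ C * (Anderson.norm1 x / Real.log (Anderson.norm1 x + 2)) := by
  have : NeZero d := ⟨by omega⟩
  obtain ⟨C, hC, hvar⟩ := exists_variance_shiftAvg_rho_le hd ha hab
  set K := Real.log (harnackConst d b) with hKdef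
  have hlog : 0 < Real.log 256 := Real.log_pos (by norm_num)
  -- `8 * K * m` bounds the error of the spatial averaging: both endpoints move by at most `2 * m`,
  -- and `ρ` has Lipschitz constant `2 * K`.
  refine ⟨(2 * C + 2 * (8 * K) ^ 2) * (5 * Real.log 256), by positivity, ?_⟩
  intro Ω _ μ _ V hm hi hp x
  have hb := fun z => (hp z).2
  have hae := ae_forall_eq_or_eq hab hm hp
  have hK0 : 0 ≤ K := Real.log_nonneg (one_le_harnackConst (ha.trans hab))
  have hR : ∀ T : Finset (Zd d), |rho (env a b T) 0 x| ≤ 2 * natNorm x * K := fun T =>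
    abs_rho_le ha (env_mem hab T) x
  have hmem : MemLp (fun ω => rho (fun z => V z ω) 0 x) 2 μ := by
    have h : ∀ᵐ ω ∂μ, Filter.Tendsto (fun n => rho (env a b (Cube.sites V b (box d n) ω)) 0 x)
        Filter.atTop (nhds (rho (fun z => V z ω) 0 x)) := by
      filter_upwards [hae] with ω hω
      simpa using tendsto_rho_env_sites ha hab hω 0 x
    refine MemLp.of_bound (aestronglyMeasurable_of_tendsto_ae _ (fun n =>
      (Cube.measurable_comp_sites hm (fun T => rho (env a b T) 0 x) _).aestronglyMeasurable) h)
      (2 * natNorm x * K) ?_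
    filter_upwards [h] with ω hω
    exact le_of_tendsto' hω.norm fun n => hR _
  refine ⟨hmem, ?_⟩
  rw [← natNorm_cast]
  rcases Nat.eq_zero_or_pos (natNorm x) with hx | hx
  · have h0 : x = 0 := by
      funext i
      simpa using (Finset.sum_eq_zero_iff.1 hx) i (Finset.mem_univ i)
    have h1 : (fun ω => rho (fun z => V z ω) 0 x) =ᵐ[μ] fun _ => (0 : ℝ) := by
      filter_upwards [hae] with ω hω
      rw [h0]
      refine rho_self (V := fun z => V z ω) ha (b := b) (fun z => ?_) 0
      rcases hω z with h | h <;> simp only [h] <;> constructor <;> linarith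
    rw [variance_congr h1, hx, Nat.cast_zero, zero_div, mul_zero]
    exact (variance_zero μ).le
  obtain ⟨m, k, hm1, hmN, h4k, hlogN⟩ := exists_scales hx
  obtain ⟨B, hcard, hBnorm, hdiam⟩ := exists_square hd m
  have hBne : B.Nonempty := Finset.card_pos.1 (by rw [hcard]; positivity)
  have hBc : (0 : ℝ) < B.card := Nat.cast_pos.2 hBne.card_pos
  set Y : Ω → ℝ := fun ω => (∑ w ∈ B, rho (fun z => V z ω) w (x + w)) / B.card with hY
  -- Large enough to contain every translate of the box by `w ∈ B`, so that one cube carries all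
  -- terms of the average.
  let Λ' : ℕ → Finset (Zd d) := fun n => (box d n ×ˢ B).image fun p => p.1 + p.2
  have hΛ' : ∀ n, ∀ w ∈ B, ∀ u ∈ box d n, u + w ∈ Λ' n := fun n w hw u hu =>
    Finset.mem_image.2 ⟨(u, w), Finset.mem_product.2 ⟨hu, hw⟩, rfl⟩
  let F : ℕ → Finset (Zd d) → ℝ := fun n => Cube.shiftAvg (box d n) B fun T => rho (env a b T) 0 x
  have hYvar : MemLp Y 2 μ ∧ Var[Y; μ] ≤ C * (natNorm x / (k + 1)) := by
    refine variance_le_of_tendsto (f := fun n ω => F n (Cube.sites V b (Λ' n) ω))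
      (K := 2 * natNorm x * K)
      (fun n => (Cube.measurable_comp_sites hm (F n) _).aestronglyMeasurable) (fun n ω => ?_) ?_
      (fun n => ?_)
    · simp only [F, Cube.shiftAvg]
      rw [abs_div, abs_of_pos hBc, div_le_iff₀ hBc, mul_comm _ (B.card : ℝ), ← nsmul_eq_mul]
      exact (Finset.abs_sum_le_sum_abs _ _).trans (Finset.sum_le_card_nsmul _ _ _ fun w _ => hR _)
    · filter_upwards [hae] with ω hω
      refine (tendsto_finsetSum B fun w hw => ?_).div_const _
      simp only [shift_sites (hΛ' _ w hw)]
      exact tendsto_rho_env_sites ha hab hω w x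
    · rw [Cube.integral_comp_sites hm hi hb (F n),
        Cube.integral_comp_sites hm hi hb (fun T => F n T ^ 2)]
      exact hvar x m k B (box d n) (Λ' n) hx hm1 h4k hcard hdiam fun w hw g =>
        avg_shift hm hi hb (hΛ' n w hw) g
  have hdiff : ∀ᵐ ω ∂μ, |rho (fun z => V z ω) 0 x - Y ω| ≤ 8 * K * m := by
    filter_upwards [hae] with ω hω
    have hV : ∀ z, a ≤ V z ω ∧ V z ω ≤ b := fun z => by
      rcases hω z with h | h <;> rw [h] <;> constructor <;> linarith
    have e : rho (fun z => V z ω) 0 x - Y ω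
        = (∑ w ∈ B, (rho (fun z => V z ω) 0 x - rho (fun z => V z ω) w (x + w))) / B.card := by
      rw [Finset.sum_sub_distrib, Finset.sum_const, nsmul_eq_mul, sub_div,
        mul_div_cancel_left₀ _ hBc.ne']
    rw [e, abs_div, abs_of_pos hBc, div_le_iff₀ hBc, mul_comm _ (B.card : ℝ), ← nsmul_eq_mul]
    refine (Finset.abs_sum_le_sum_abs _ _).trans (Finset.sum_le_card_nsmul _ _ _ fun w hw => ?_)
    refine (abs_rho_sub_le ha hV 0 x w (x + w)).trans ?_
    rw [sub_zero, add_sub_cancel_left]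
    have h1 : (natNorm w : ℝ) ≤ 2 * m := by exact_mod_cast hBnorm w hw
    calc _ ≤ 2 * (2 * m + 2 * m) * K := by gcongr
      _ = _ := by ring
  have hfin := variance_le_of_abs_sub_le hmem hYvar.1 hdiff
  have hN : (0 : ℝ) ≤ natNorm x := Nat.cast_nonneg _
  have hlogpos : 0 < Real.log (natNorm x + 2) := Real.log_pos (by linarith)
  calc _ ≤ 2 * (C * (natNorm x / (k + 1))) + 2 * (8 * K * m) ^ 2 := by linarith [hfin, hYvar.2]
    _ = 2 * C * (natNorm x / (k + 1)) + 2 * (8 * K) ^ 2 * m ^ 2 := by ring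
    _ ≤ 2 * C * (natNorm x / (k + 1)) + 2 * (8 * K) ^ 2 * (natNorm x / (k + 1)) := by gcongr
    _ = (2 * C + 2 * (8 * K) ^ 2) * (natNorm x / (k + 1)) := by ring
    _ ≤ (2 * C + 2 * (8 * K) ^ 2) *
        (5 * Real.log 256 * (natNorm x / Real.log (natNorm x + 2))) := by
        refine mul_le_mul_of_nonneg_left ?_ (by positivity)
        rw [← mul_div_assoc, div_le_div_iff₀ (by positivity) hlogpos]
        nlinarith [mul_le_mul_of_nonneg_left hlogN hN]
    _ = _ := by ring
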